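/- Let $\Sigma$ be the infinite trivalent plane tree dual to the Farey triangulation and let $\Omega\cong\mathbb{Q}\cup\{\infty\}$ be its set of complementary regions. Colour a region $1$, $2$ or $3$ according to whether its slope is congruent to $0/1$, $1/0$ or $1/1$ modulo $2$; then the three regions around any vertex have different colours. For $\mu=(p,q,r,s)\in\mathbb{C}^4$, a $\mu$-Markoff map is a function $\phi:\Omega\to\mathbb{C}$ such that (i) if regions $X,Y,Z$ of colours $1,2,3$ meet at a vertex, then $x=\phi(X)$, $y=\phi(Y)$, $z=\phi(Z)$ satisfy $x^2+y^2+z^2+xyz=px+qy+rz+s$; (ii) along every edge the edge relation of the appropriate colour holds: $x+x'=p-yz$ if the edge is $Y\cap Z$ and $X,X'$ are the regions at its two ends, and likewise $y+y'=q-xz$ for an edge $X\cap Z$, and $z+z'=r-xy$ for an edge $X\cap Y$. The set $\Phi_\mu$ of these maps has the topology induced from $\mathbb{C}^3$ by evaluation at the three regions of slopes $0,\infty,-1$. A vertex is a sink of $\phi$ if for each of its three regions $X$ one has $|\phi(X)|\le|\phi(X')|$, where $X'$ is the region at the other end of the edge opposite to $X$. Call $m\in\mathbb{R}$ a sink bound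 for $\mu$ if at every sink of every $\phi\in\Phi_\mu$ at least one of the three regions has a value of modulus at most $m$. Let $\mathrm{GT}(a,b,c,d)=(ab+cd,\;ad+bc,\;ac+bd,\;4-a^2-b^2-c^2-d^2-abcd)$. Let $\mathcal{S}_\mu$ be the finite set of all roots of the polynomials $x^2-uvx+u^2+v^2-4$, where $u,v$ are two of the four entries of some $(a,b,c,d)$ with $\mathrm{GT}(a,b,c,d)=\mu$. Let $\alpha=\frac12\max\{|p|,|q|,|r|\}$, let $M$ be the maximum of $\left|\frac{2p_i-xp_j}{4-x^2}\right|$ over $x\in\mathcal{S}_\mu\setminus\{\pm2\}$ and $i\ne j$, where $(p_1,p_2,p_3)=(p,q,r)$ (and $M=0$ if there is no such $x$), and put $L=L(\mu)=\max\{2+\alpha,\,m,\,M+1\}$, where $m>2$ is a sink bound for $\mu$. A map $\phi\in\Phi_\mu$ satisfies the BQ-conditions if $\phi(X)\notin[-2,2]$ for every $X\in\Omega$ and $|\phi(X)|\le L$ for only finitely many $X\in\Omega$. **Theorem.** Let $\mu\in\mathbb{C}^4$. Sink bounds $m>2$ for $\mu$ exist, and for each choice of such an $m$: (1) the set of $\mu$-Markoff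 maps satisfying the BQ-conditions is open in $\Phi_\mu$; (2) for every $\tau=(a,b,c,d)$ with $\mathrm{GT}(\tau)=\mu$, the Bowditch characters form an open subset of the relative character variety $\mathcal{X}_\tau$. Here $\Gamma=\langle\alpha,\beta,\gamma,\delta\mid\alpha\beta\gamma\delta\rangle$ is the fundamental group of the four-holed sphere. The space $\mathcal{X}_\tau$ is the quotient of the space of representations $\rho:\Gamma\to\mathrm{SL}(2,\mathbb{C})$ with boundary traces $a,b,c,d$ (with the topology of pointwise convergence) by the equivalence relation generated by identifying $\rho$ with every point of the closure of its conjugation orbit. A Bowditch character is the class of a $\rho$ such that $\operatorname{tr}\rho(g)\notin[-2,2]$ for all essential non-peripheral simple closed curves $g$, and $|\operatorname{tr}\rho(g)|\le L(\mathrm{GT}(\tau))$ for only finitely many free homotopy classes of such unoriented curves $g$. -/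

import Mathlib

/-! ### The trivalent plane tree, through its dual, the Farey triangulation -/

/-- A complementary region of the trivalent tree dual to the Farey triangulation, named by the
Farey vertex (slope) in `ℚ ∪ {∞}` which it contains. -/
abbrev Region : Type := OnePoint ℚ

namespace Region

/-- Numerator of a slope in lowest terms, with `∞ = 1/0`. -/
def num : Region → ℤ
  | none => 1
  | some x => x.num

/-- Denominator of a slope in lowest terms, with `∞ = 1/0`. -/
def den : Region → ℤ
  | none => 0
  | some x => x.den

/-- Two regions share an edge of the tree iff their slopes are joined by a Farey geodesic. -/
def Adj (X Y : Region) : Prop := |X.num * Y.den - X.den * Y.num| = 1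

/-- The tri-colouring of the regions: slopes congruent to `0/1`, `1/0`, `1/1` modulo 2 have
colour 1, 2, 3. -/
def color (X : Region) : ℕ :=
  if X.num % 2 = 0 then 1 else if X.den % 2 = 0 then 2 else 3

/-- `X, Y, Z` are the three regions around a vertex of the tree (a Farey triangle). -/
def IsVertex (X Y Z : Region) : Prop := Adj X Y ∧ Adj Y Z ∧ Adj X Z

/-- `e ↔ (X, Y; Z, W)`: the edge `e = X ∩ Y` has its two ends on `Z` and on `W`. -/
def IsEdge (X Y Z W : Region) : Prop := IsVertex X Y Z ∧ IsVertex X Y W ∧ Z ≠ W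

/-- The three regions around the base vertex: slopes `0`, `∞`, `-1`, of colours 1, 2, 3. -/
def X₀ : Region := ((0 : ℚ) : OnePoint ℚ)
def Y₀ : Region := OnePoint.infty
def Z₀ : Region := ((-1 : ℚ) : OnePoint ℚ)

end Region

/-! ### Markoff maps -/

/-- A parameter `μ = (p, q, r, s) ∈ ℂ⁴`. -/
@[ext] structure MarkoffParam where
  p : ℂ
  q : ℂ
  r : ℂ
  s : ℂ

/-- The Goldman–Toledo map `(a, b, c, d) ↦ (p, q, r, s)`. -/
noncomputable def GT (τ : Fin 4 → ℂ) : MarkoffParam where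
  p := τ 0 * τ 1 + τ 2 * τ 3
  q := τ 0 * τ 3 + τ 1 * τ 2
  r := τ 0 * τ 2 + τ 1 * τ 3
  s := 4 - τ 0 ^ 2 - τ 1 ^ 2 - τ 2 ^ 2 - τ 3 ^ 2 - τ 0 * τ 1 * τ 2 * τ 3

/-- `(x, y, z)` is a `μ`-Markoff triple. -/
def IsMarkoffTriple (μ : MarkoffParam) (x y z : ℂ) : Prop :=
  x ^ 2 + y ^ 2 + z ^ 2 + x * y * z = μ.p * x + μ.q * y + μ.r * z + μ.s

open Region in
/-- `μ`-Markoff maps: the vertex relation at every vertex, and the edge relation of the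
appropriate colour along every edge. -/
structure MarkoffMap (μ : MarkoffParam) where
  toFun : Region → ℂ
  vertex : ∀ X Y Z : Region, color X = 1 → color Y = 2 → color Z = 3 → IsVertex X Y Z →
    IsMarkoffTriple μ (toFun X) (toFun Y) (toFun Z)
  edge₁ : ∀ Y Z X X' : Region, color Y = 2 → color Z = 3 → IsEdge Y Z X X' →
    toFun X + toFun X' = μ.p - toFun Y * toFun Z
  edge₂ : ∀ X Z Y Y' : Region, color X = 1 → color Z = 3 → IsEdge X Z Y Y' →
    toFun Y + toFun Y' = μ.q - toFun X * toFun Z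
  edge₃ : ∀ X Y Z Z' : Region, color X = 1 → color Y = 2 → IsEdge X Y Z Z' →
    toFun Z + toFun Z' = μ.r - toFun X * toFun Y

instance (μ : MarkoffParam) : CoeFun (MarkoffMap μ) (fun _ => Region → ℂ) := ⟨MarkoffMap.toFun⟩

/-- The topology on the set of `μ`-Markoff maps, induced from `ℂ³` by evaluation at the three
regions around the base vertex. -/
noncomputable instance (μ : MarkoffParam) : TopologicalSpace (MarkoffMap μ) :=
  TopologicalSpace.induced
    (fun φ => ((φ Region.X₀, φ Region.Y₀, φ Region.Z₀) : ℂ × ℂ × ℂ)) inferInstance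

/-! ### The constant `L(μ)` -/

/-- The vertex with regions `X, Y, Z` is a sink of `φ`: on each of its three edges the arrow
(from the larger to the smaller value, with an arbitrary choice at a tie) can point to it. -/
def IsSink {μ : MarkoffParam} (φ : MarkoffMap μ) (X Y Z : Region) : Prop :=
  Region.IsVertex X Y Z ∧
  (∀ X', Region.IsEdge Y Z X X' → ‖φ X‖ ≤ ‖φ X'‖) ∧
  (∀ Y', Region.IsEdge X Z Y Y' → ‖φ Y‖ ≤ ‖φ Y'‖) ∧
  (∀ Z', Region.IsEdge X Y Z Z' → ‖φ Z‖ ≤ ‖φ Z'‖)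

/-- At every sink of every `μ`-Markoff map some region has a value of modulus at most `m`. -/
def IsSinkBound (μ : MarkoffParam) (m : ℝ) : Prop :=
  ∀ (φ : MarkoffMap μ) (X Y Z : Region), IsSink φ X Y Z → min (min ‖φ X‖ ‖φ Y‖) ‖φ Z‖ ≤ m

namespace MarkoffParam

/-- The triple `(p, q, r)`. -/
noncomputable def coeff (μ : MarkoffParam) : Fin 3 → ℂ := ![μ.p, μ.q, μ.r]

/-- `α(μ) = max {|p|, |q|, |r|} / 2`. -/
noncomputable def alpha (μ : MarkoffParam) : ℝ := max (max ‖μ.p‖ ‖μ.q‖) ‖μ.r‖ / 2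

/-- The finite set `S_μ` of all roots of the polynomials `x² - u v x + u² + v² - 4`, where `u, v`
are two of the four entries of some `(a, b, c, d)` with `GT (a, b, c, d) = μ`. -/
def degenerateValues (μ : MarkoffParam) : Set ℂ :=
  {x | ∃ τ : Fin 4 → ℂ, GT τ = μ ∧ ∃ i j : Fin 4, i ≠ j ∧
    x ^ 2 - τ i * τ j * x + τ i ^ 2 + τ j ^ 2 - 4 = 0}

/-- `M(μ)`: the largest modulus of a coordinate of the centre of a degenerate conic
(a maximum over a finite set, read as `0` if that set is empty). -/
noncomputable def centerBound (μ : MarkoffParam) : ℝ :=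
  sSup {t : ℝ | ∃ x ∈ μ.degenerateValues \ {2, -2}, ∃ i j : Fin 3, i ≠ j ∧
    t = ‖(2 * μ.coeff i - x * μ.coeff j) / (4 - x ^ 2)‖}

/-- `L(μ) = max {2 + α(μ), m, M(μ) + 1}`, where `m` is the chosen sink bound. -/
noncomputable def L (μ : MarkoffParam) (m : ℝ) : ℝ :=
  max (max (2 + μ.alpha) m) (μ.centerBound + 1)

end MarkoffParam

/-- The real interval `[-2, 2]` inside `ℂ`. -/
def interval22 : Set ℂ := (fun t : ℝ => (t : ℂ)) '' Set.Icc (-2) 2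

/-- The Markoff maps which satisfy the BQ-conditions (with the constant `L(μ)` formed with `m`). -/
def bowditchMarkoffMaps (μ : MarkoffParam) (m : ℝ) : Set (MarkoffMap μ) :=
  {φ | (∀ X : Region, φ X ∉ interval22) ∧ {X : Region | ‖φ X‖ ≤ μ.L m}.Finite}

/-! ### The four-holed sphere group and its simple closed curves -/

/-- The only relator `α β γ δ`. -/
def sphereRel : Set (FreeGroup (Fin 4)) :=
  {FreeGroup.of 0 * FreeGroup.of 1 * FreeGroup.of 2 * FreeGroup.of 3}

/-- The fundamental group `⟨α, β, γ, δ | α β γ δ⟩` of the four-holed sphere. -/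
abbrev SphereGroup : Type := PresentedGroup sphereRel

namespace SphereGroup

/-- The generators `α, β, γ, δ`, numbered `0, 1, 2, 3`; they are the boundary curves. -/
def gen (i : Fin 4) : SphereGroup := PresentedGroup.of i

theorem gen_rel : gen 0 * gen 1 * gen 2 * gen 3 = 1 :=
  (QuotientGroup.eq_one_iff _).2 (Subgroup.subset_normalClosure rfl)

/-- The endomorphism with prescribed images of the generators. -/
def lift (f : Fin 4 → SphereGroup) (h : f 0 * f 1 * f 2 * f 3 = 1) :
    SphereGroup →* SphereGroup :=
  PresentedGroup.toGroup (f := f) (by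
    rintro w rfl
    simpa using h)

@[simp] theorem lift_gen (f : Fin 4 → SphereGroup) (h) (i : Fin 4) : lift f h (gen i) = f i :=
  PresentedGroup.toGroup.of _

theorem hom_ext {f g : SphereGroup →* SphereGroup} (h : ∀ i, f (gen i) = g (gen i)) : f = g :=
  PresentedGroup.ext h

/-- The half twist exchanging the boundary components `α` and `β`:
`α ↦ α β α⁻¹`, `β ↦ α`, `γ ↦ γ`, `δ ↦ δ`. -/
def halfTwist₁ : MulAut SphereGroup :=
  MonoidHom.toMulEquiv
    (lift ![gen 0 * gen 1 * (gen 0)⁻¹, gen 0, gen 2, gen 3] (by simp [gen_rel]))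
    (lift ![gen 1, (gen 1)⁻¹ * gen 0 * gen 1, gen 2, gen 3]
      (by simpa [mul_assoc] using gen_rel))
    (hom_ext fun i => by fin_cases i <;> simp [mul_assoc])
    (hom_ext fun i => by fin_cases i <;> simp [mul_assoc])

/-- The half twist exchanging the boundary components `β` and `γ`:
`α ↦ α`, `β ↦ β γ β⁻¹`, `γ ↦ β`, `δ ↦ δ`. -/
def halfTwist₂ : MulAut SphereGroup :=
  MonoidHom.toMulEquiv
    (lift ![gen 0, gen 1 * gen 2 * (gen 1)⁻¹, gen 1, gen 3]
      (by simpa [mul_assoc] using gen_rel))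
    (lift ![gen 0, gen 2, (gen 2)⁻¹ * gen 1 * gen 2, gen 3]
      (by simpa [mul_assoc] using gen_rel))
    (hom_ext fun i => by fin_cases i <;> simp [mul_assoc])
    (hom_ext fun i => by fin_cases i <;> simp [mul_assoc])

/-- The action on the fundamental group of the mapping class group of the sphere with four holes
in which the hole `δ` is fixed: the Artin action of the braid group on three strands. -/
def mappingClasses : Subgroup (MulAut SphereGroup) :=
  Subgroup.closure {halfTwist₁, halfTwist₂}

/-- `g ∼ h`: `g` is conjugate to `h` or to `h⁻¹`. -/
def CurveRel (g h : SphereGroup) : Prop := IsConj g h ∨ IsConj g h⁻¹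

/-- Free homotopy classes of unoriented closed curves on the four-holed sphere. -/
def Curve : Type := Quot CurveRel

/-- The classes of the essential non-peripheral simple closed curves. Such a curve bounds a disc
which contains exactly two of the three holes `α, β, γ` (and not `δ`), and the mapping class
group acts transitively on these curves, so that they form the orbit of the curve `α β`. -/
def simpleCurves : Set Curve :=
  {c | ∃ θ ∈ mappingClasses, c = Quot.mk CurveRel (θ (gen 0 * gen 1))}

end SphereGroup

/-! ### The relative character variety -/

/-- Representations of the four-holed sphere group in `SL(2, ℂ)` for which the four boundary
curves have the traces `τ = (a, b, c, d)`. -/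
def RelRep (τ : Fin 4 → ℂ) : Type :=
  {ρ : SphereGroup →* Matrix.SpecialLinearGroup (Fin 2) ℂ //
    ∀ i, (ρ (SphereGroup.gen i)).1.trace = τ i}

/-- The topology of pointwise convergence. -/
noncomputable instance (τ : Fin 4 → ℂ) : TopologicalSpace (RelRep τ) :=
  TopologicalSpace.induced
    (fun ρ => (fun g => ρ.1 g : SphereGroup → Matrix.SpecialLinearGroup (Fin 2) ℂ)) inferInstance

/-- The orbit of a representation under conjugation by `SL(2, ℂ)`. -/
def conjOrbit {τ : Fin 4 → ℂ} (ρ : RelRep τ) : Set (RelRep τ) :=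
  {ρ' | ∃ A : Matrix.SpecialLinearGroup (Fin 2) ℂ, ∀ g, ρ'.1 g = A * ρ.1 g * A⁻¹}

/-- The relative character variety: the quotient of the space of representations, with the
quotient topology, by the equivalence relation which is generated by identifying `ρ` with all
points of the closure of its conjugation orbit. -/
abbrev RelCharVariety (τ : Fin 4 → ℂ) : Type :=
  Quot (fun ρ ρ' : RelRep τ => ρ' ∈ closure (conjOrbit ρ))

/-- The BQ-conditions for a representation, with the constant `K`. -/
def RelRep.IsBowditch {τ : Fin 4 → ℂ} (ρ : RelRep τ) (K : ℝ) : Prop :=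
  (∀ g : SphereGroup, Quot.mk _ g ∈ SphereGroup.simpleCurves → (ρ.1 g).1.trace ∉ interval22) ∧
  {c ∈ SphereGroup.simpleCurves |
    ∃ g : SphereGroup, Quot.mk _ g = c ∧ ‖(ρ.1 g).1.trace‖ ≤ K}.Finite

/-- The Bowditch characters: the classes of the representations which satisfy the BQ-conditions
with the constant `K(τ) = L(GT τ)`. -/
def bowditchCharacters (τ : Fin 4 → ℂ) (m : ℝ) : Set (RelCharVariety τ) :=
  {χ | ∃ ρ : RelRep τ, Quot.mk _ ρ = χ ∧ ρ.IsBowditch ((GT τ).L m)}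

/-! Regions of the tree are primitive integral vectors up to sign, and a vertex is a basis `u, v` of
`ℤ²` together with `u + v`. In this language Markoff maps and the traces of a representation on
simple closed curves are both instances of `IsVectorMarkoff`, so openness is proved once, in
`isOpen_isVectorBowditch`, for any family of such functions with continuous values.

At a point satisfying the BQ-conditions the small regions have bounded coordinates. It suffices that
suitable edges stay good (`GoodBeyond`) under perturbation, and an edge is good when the two edges
following it are. If every region beyond an edge exceeds `L`, the edge relation and `L ≥ 2 + α`
force growth after finitely many steps. Growth starts with strict inequalities and then propagates
(`lt_norm_of_growth`, `eventually_goodBeyond_of_lt`). If an adjacent region `u` may be small,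
infinitely many edges along its boundary must be handled at once. Put `x = f u`. Measured from the
centre of the conic of `u`, the boundary values solve a linear recurrence with multipliers `λ, λ⁻¹`,
and `|λ| > 1` because `x ∉ [-2, 2]`. If the coefficient of `λⁿ` vanished, the conic would be
degenerate, `x` would lie in `S_μ`, and the values would tend to coordinates of modulus at most `M ≤
L - 1`, which is excluded when all but finitely many regions exceed `L`. The coefficient is
therefore nonzero, and growth is locally uniform (`eventually_lt_norm_boundaryVec`).

For characters, the mapping class group acts on slopes through `SL₂(ℤ)`, which carries the trace
identities from one basis to all (`isVectorMarkoff_charTrace`). A representation with monomial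
traces separates slopes (`eq_or_eq_neg_of_curveRel`). Traces are constant on closures of orbits, so
openness descends to the quotient. Sink bounds come from combining the vertex relation with Vieta's
formula at the three edges of a sink. -/

open Filter Topology

/-! ### Markoff functions on integral vectors -/

/-- The index of the colour class of an integral vector modulo 2. -/
def vectorColor (u : ℤ × ℤ) : Fin 3 :=
  if u.1 % 2 = 0 then 0 else if u.2 % 2 = 0 then 1 else 2

/-- The determinant of two integral vectors. -/
def vectorDet (u v : ℤ × ℤ) : ℤ := u.1 * v.2 - u.2 * v.1

/-- Even functions on integral vectors which satisfy the edge and vertex relations at all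
oriented bases of `ℤ²`. -/
structure IsVectorMarkoff (μ : MarkoffParam) (f : ℤ × ℤ → ℂ) : Prop where
  neg : ∀ u, f (-u) = f u
  edge : ∀ u v, vectorDet u v = 1 →
    f (u + v) + f (u - v) = μ.coeff (vectorColor (u + v)) - f u * f v
  vertex : ∀ u v, vectorDet u v = 1 →
    f u ^ 2 + f v ^ 2 + f (u + v) ^ 2 + f u * f v * f (u + v) =
      μ.coeff (vectorColor u) * f u + μ.coeff (vectorColor v) * f v
        + μ.coeff (vectorColor (u + v)) * f (u + v) + μ.s

/-- `u, v` is a basis of `ℤ²`. -/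
def IsVectorBasis (u v : ℤ × ℤ) : Prop := vectorDet u v = 1 ∨ vectorDet u v = -1

/-- The vector with coordinates `a, b` in the basis `u, v`. -/
def vectorComb (u v : ℤ × ℤ) (a b : ℕ) : ℤ × ℤ := (a * u.1 + b * v.1, a * u.2 + b * v.2)

theorem vectorColor_neg (u : ℤ × ℤ) : vectorColor (-u) = vectorColor u := by
  simp [vectorColor, Int.neg_emod_two]

theorem vectorColor_congr {u v : ℤ × ℤ} (h1 : u.1 % 2 = v.1 % 2) (h2 : u.2 % 2 = v.2 % 2) :
    vectorColor u = vectorColor v := by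
  simp [vectorColor, h1, h2]

theorem vectorColor_sub (u v : ℤ × ℤ) : vectorColor (u - v) = vectorColor (u + v) :=
  vectorColor_congr (by simp; omega) (by simp; omega)

theorem IsVectorBasis.left {u v : ℤ × ℤ} (h : IsVectorBasis u v) : IsVectorBasis u (u + v) := by
  unfold IsVectorBasis vectorDet at *
  simp only [Prod.fst_add, Prod.snd_add]
  ring_nf at h ⊢
  exact h

theorem IsVectorBasis.swap {u v : ℤ × ℤ} (h : IsVectorBasis u v) : IsVectorBasis v u := by
  unfold IsVectorBasis vectorDet at *
  rcases h with h | h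
  · right; linarith
  · left; linarith

theorem IsVectorBasis.right {u v : ℤ × ℤ} (h : IsVectorBasis u v) : IsVectorBasis (u + v) v := by
  have := h.swap.left.swap
  rwa [add_comm v u] at this

theorem IsVectorBasis.odd {u v : ℤ × ℤ} (h : IsVectorBasis u v) : vectorDet u v % 2 = 1 := by
  rcases h with h | h <;> rw [h] <;> rfl

/-- The determinant is odd, so modulo 2 the two vectors and their sum are the three nonzero vectors
of the plane over the field with two elements. -/
theorem vectorColor_cases {u v : ℤ × ℤ} (h : IsVectorBasis u v) :
    vectorColor u ≠ vectorColor v ∧ vectorColor u ≠ vectorColor (u + v) ∧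
      vectorColor v ≠ vectorColor (u + v) := by
  have h1 := h.odd
  unfold vectorDet at h1
  have h2 : ((u.1 % 2) * (v.2 % 2) - (u.2 % 2) * (v.1 % 2)) % 2 = 1 := by
    rw [← h1]
    exact (((Int.mod_modEq u.1 2).mul (Int.mod_modEq v.2 2)).sub
      ((Int.mod_modEq u.2 2).mul (Int.mod_modEq v.1 2)))
  simp only [vectorColor, Prod.fst_add, Prod.snd_add, Int.add_emod u.1, Int.add_emod u.2]
  have a := Int.emod_two_eq_zero_or_one u.1
  have b := Int.emod_two_eq_zero_or_one u.2
  have c := Int.emod_two_eq_zero_or_one v.1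
  have d := Int.emod_two_eq_zero_or_one v.2
  generalize u.1 % 2 = x at *
  generalize u.2 % 2 = y at *
  generalize v.1 % 2 = z at *
  generalize v.2 % 2 = w at *
  rcases a with rfl | rfl <;> rcases b with rfl | rfl <;> rcases c with rfl | rfl <;>
    rcases d with rfl | rfl <;> simp_all

namespace IsVectorMarkoff

variable {μ : MarkoffParam} {f : ℤ × ℤ → ℂ}

/-- Replacing `v` by `-v` reverses the orientation and only exchanges the two ends of the edge,
which have equal colour. -/
theorem edge_of_basis (hf : IsVectorMarkoff μ f) {u v : ℤ × ℤ} (h : IsVectorBasis u v) :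
    f (u + v) + f (u - v) = μ.coeff (vectorColor (u + v)) - f u * f v := by
  rcases h with h | h
  · exact hf.edge u v h
  · have := hf.edge u (-v) (by simp only [vectorDet, Prod.fst_neg, Prod.snd_neg] at *; linarith)
    rw [hf.neg, ← sub_eq_add_neg, sub_neg_eq_add, vectorColor_sub] at this
    rw [← this, add_comm]

theorem vertex_of_basis (hf : IsVectorMarkoff μ f) {u v : ℤ × ℤ} (h : IsVectorBasis u v) :
    f u ^ 2 + f v ^ 2 + f (u + v) ^ 2 + f u * f v * f (u + v) =
      μ.coeff (vectorColor u) * f u + μ.coeff (vectorColor v) * f v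
        + μ.coeff (vectorColor (u + v)) * f (u + v) + μ.s := by
  rcases h with h | h
  · exact hf.vertex u v h
  · have := hf.vertex v u (by simp only [vectorDet] at *; linarith)
    rw [add_comm v u] at this
    linear_combination this

end IsVectorMarkoff

theorem vectorComb_swap (u v : ℤ × ℤ) (a b : ℕ) : vectorComb u v a b = vectorComb v u b a := by
  ext <;> simp [vectorComb] <;> ring

theorem vectorComb_left (u v : ℤ × ℤ) (a b : ℕ) :
    vectorComb u (u + v) a b = vectorComb u v (a + b) b := by
  ext <;> simp [vectorComb] <;> ring

theorem vectorComb_right (u v : ℤ × ℤ) (a b : ℕ) :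
    vectorComb (u + v) v a b = vectorComb u v a (a + b) := by
  ext <;> simp [vectorComb] <;> ring

/-! ### Good edges and growth -/

/-- The part of the BQ-conditions which concerns the regions beyond the edge `u, v`. -/
def GoodBeyond (L : ℝ) (f : ℤ × ℤ → ℂ) (u v : ℤ × ℤ) : Prop :=
  (∀ a b : ℕ, a.Coprime b → f (vectorComb u v a b) ∉ interval22) ∧
  {q : ℕ × ℕ | q.1.Coprime q.2 ∧ ‖f (vectorComb u v q.1 q.2)‖ ≤ L}.Finite

theorem GoodBeyond.swap {L : ℝ} {f : ℤ × ℤ → ℂ} {u v : ℤ × ℤ} (h : GoodBeyond L f u v) :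
    GoodBeyond L f v u := by
  refine ⟨fun a b hab => ?_, (h.2.image Prod.swap).subset ?_⟩
  · rw [vectorComb_swap]; exact h.1 b a hab.symm
  · rintro ⟨a, b⟩ ⟨hab, hle⟩
    refine ⟨(b, a), ⟨hab.symm, ?_⟩, rfl⟩
    rw [vectorComb_swap]; exact hle

/-- Coprime coordinates pass to one of the two edges which follow. -/
theorem coprime_cases {P : ℕ → ℕ → Prop} (hl : ∀ a b, a.Coprime b → P (a + b) b)
    (hr : ∀ a b, a.Coprime b → P a (a + b)) (a b : ℕ) (hab : a.Coprime b) : P a b := by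
  rcases le_total b a with h | h
  · obtain ⟨c, rfl⟩ := Nat.exists_eq_add_of_le' h
    exact hl c b (by simpa using hab)
  · obtain ⟨c, rfl⟩ := Nat.exists_eq_add_of_le h
    exact hr a c (by simpa using hab)

theorem GoodBeyond.of_children {L : ℝ} {f : ℤ × ℤ → ℂ} {u v : ℤ × ℤ}
    (hl : GoodBeyond L f u (u + v)) (hr : GoodBeyond L f (u + v) v) : GoodBeyond L f u v := by
  constructor
  · apply coprime_cases
    · intro a b hab; rw [← vectorComb_left]; exact hl.1 a b hab
    · intro a b hab; rw [← vectorComb_right]; exact hr.1 a b hab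
  · refine ((hl.2.image fun q => (q.1 + q.2, q.2)).union
      (hr.2.image fun q => (q.1, q.1 + q.2))).subset ?_
    rintro ⟨a, b⟩ ⟨hab, hle⟩
    revert hle
    refine coprime_cases (P := fun a b => ‖f (vectorComb u v a b)‖ ≤ L → (a, b) ∈ _)
      ?_ ?_ a b hab
    · intro a b hab hle
      exact Or.inl ⟨(a, b), ⟨hab, by rw [vectorComb_left]; exact hle⟩, rfl⟩
    · intro a b hab hle
      exact Or.inr ⟨(a, b), ⟨hab, by rw [vectorComb_right]; exact hle⟩, rfl⟩

theorem norm_le_two_of_mem_interval22 {x : ℂ} (h : x ∈ interval22) : ‖x‖ ≤ 2 := by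
  obtain ⟨t, ht, rfl⟩ := h
  rw [Complex.norm_real, Real.norm_eq_abs]
  exact abs_le.2 ht

theorem goodBeyond_of_lt {L : ℝ} (hL : 2 < L) {f : ℤ × ℤ → ℂ} {u v : ℤ × ℤ}
    (h : ∀ a b : ℕ, a.Coprime b → L < ‖f (vectorComb u v a b)‖) : GoodBeyond L f u v := by
  refine ⟨fun a b hab hm => ?_, ?_⟩
  · linarith [h a b hab, norm_le_two_of_mem_interval22 hm]
  · convert Set.finite_empty
    rw [Set.eq_empty_iff_forall_notMem]
    rintro ⟨a, b⟩ ⟨hab, hle⟩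
    exact absurd (h a b hab) (not_lt.2 hle)

namespace MarkoffParam

theorem norm_coeff_le (μ : MarkoffParam) (i : Fin 3) : ‖μ.coeff i‖ ≤ 2 * μ.alpha := by
  fin_cases i <;> simp [coeff, alpha, mul_div_cancel₀]

theorem alpha_nonneg (μ : MarkoffParam) : 0 ≤ μ.alpha := by
  have := (norm_nonneg _).trans (μ.norm_coeff_le 0)
  linarith

end MarkoffParam

section Growth

variable {μ : MarkoffParam} {L : ℝ}

theorem norm_edge_ge {f : ℤ × ℤ → ℂ} (hf : IsVectorMarkoff μ f) {u v : ℤ × ℤ}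
    (h : IsVectorBasis u v) :
    ‖f u‖ * ‖f v‖ - 2 * μ.alpha ≤ ‖f (u + v)‖ + ‖f (u - v)‖ := by
  have h1 := hf.edge_of_basis h
  have h2 : f u * f v = μ.coeff (vectorColor (u + v)) - (f (u + v) + f (u - v)) := by
    rw [h1]; ring
  have h3 := norm_sub_le (μ.coeff (vectorColor (u + v))) (f (u + v) + f (u - v))
  rw [← h2, norm_mul] at h3
  linarith [norm_add_le (f (u + v)) (f (u - v)), μ.norm_coeff_le (vectorColor (u + v))]

/-- Once the region ahead of an edge dominates both adjacent ones, the same holds at the two edges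
that follow: the product of the adjacent values outweighs the value behind and the coefficient. The
induction follows the Euclidean algorithm on the coordinates. -/
theorem lt_norm_of_growth (hL : 2 < L) (hα : 2 + μ.alpha ≤ L) {f : ℤ × ℤ → ℂ}
    (hf : IsVectorMarkoff μ f) (n : ℕ) : ∀ {u v : ℤ × ℤ}, IsVectorBasis u v →
    L < ‖f u‖ → L < ‖f v‖ → ‖f u‖ ≤ ‖f (u + v)‖ → ‖f v‖ ≤ ‖f (u + v)‖ →
    ∀ a b : ℕ, a + b ≤ n → a.Coprime b → L < ‖f (vectorComb u v a b)‖ := by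
  have hα0 := μ.alpha_nonneg
  have key : ∀ {u v : ℤ × ℤ}, IsVectorBasis u v →
      L < ‖f u‖ → ‖f v‖ ≤ ‖f (u + v)‖ → L < ‖f (u + v)‖ →
      ‖f (u + v)‖ ≤ ‖f (u + (u + v))‖ := by
    intro u v h hu hv hw
    have h1 := norm_edge_ge hf h.left
    rw [show u - (u + v) = -v by abel, hf.neg] at h1
    -- With `w = u + v`: since `‖f u‖ - 2 > α` and `‖f w‖ > 2`, the excess `(‖f u‖ - 2) ‖f w‖`
    -- covers `2α`.
    nlinarith
  induction n with
  | zero =>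
    intro u v _ _ _ _ _ a b hn hab
    obtain ⟨rfl, rfl⟩ : a = 0 ∧ b = 0 := by omega
    simp at hab
  | succ n ih =>
    intro u v h hu hv hwu hwv a b hn hab
    have hw : L < ‖f (u + v)‖ := hu.trans_le hwu
    rcases Nat.eq_zero_or_pos a with rfl | ha
    · obtain rfl : b = 1 := by simpa using hab
      simpa [vectorComb] using hv
    rcases Nat.eq_zero_or_pos b with rfl | hb
    · obtain rfl : a = 1 := by simpa using hab
      simpa [vectorComb] using hu
    rcases le_total b a with hba | hba
    · obtain ⟨c, rfl⟩ := Nat.exists_eq_add_of_le' hba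
      rw [← vectorComb_left]
      have := key h hu hwv hw
      exact ih h.left hu hw (hwu.trans this) this c b (by omega) (by simpa using hab)
    · obtain ⟨c, rfl⟩ := Nat.exists_eq_add_of_le hba
      rw [← vectorComb_right]
      have := key h.swap hv (by rwa [add_comm]) (by rwa [add_comm])
      rw [add_comm v u, add_comm v (u + v)] at this
      exact ih h.right hw hv this (hwv.trans this) a c (by omega) (by simpa using hab)

theorem goodBeyond_of_growth (hL : 2 < L) (hα : 2 + μ.alpha ≤ L) {f : ℤ × ℤ → ℂ}
    (hf : IsVectorMarkoff μ f) {u v : ℤ × ℤ} (h : IsVectorBasis u v)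
    (hu : L < ‖f u‖) (hv : L < ‖f v‖) (hwu : ‖f u‖ ≤ ‖f (u + v)‖) (hwv : ‖f v‖ ≤ ‖f (u + v)‖) :
    GoodBeyond L f u v :=
  goodBeyond_of_lt hL fun a b hab =>
    lt_norm_of_growth hL hα hf _ h hu hv hwu hwv a b le_rfl hab

variable {Φ : Type*} [TopologicalSpace Φ] {F : Φ → ℤ × ℤ → ℂ}

/-- If all values beyond an edge exceed `L`, the edge stays good under perturbation. -/
theorem eventually_goodBeyond_of_lt (hL : 2 < L) (hα : 2 + μ.alpha ≤ L)
    (hF : ∀ φ, IsVectorMarkoff μ (F φ)) (hc : ∀ u, Continuous fun φ => F φ u) (φ₀ : Φ)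
    (u v : ℤ × ℤ) (h : IsVectorBasis u v)
    (hlt : ∀ a b : ℕ, a.Coprime b → L < ‖F φ₀ (vectorComb u v a b)‖) :
    ∀ᶠ φ in 𝓝 φ₀, GoodBeyond L (F φ) u v := by
  have hα0 := μ.alpha_nonneg
  -- For two numbers above `L`, the product less `2α` exceeds twice either factor by at least `2δ`.
  -- Hence each step across an edge whose larger end is behind lowers the value behind by more than
  -- `δ`, and `n` counts the steps left.
  set δ : ℝ := ((L - 2) * L - 2 * μ.alpha) / 2 with hδ
  have hδ0 : 0 < δ := by rw [hδ]; nlinarith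
  obtain ⟨n, hn⟩ := exists_nat_gt (‖F φ₀ (u - v)‖ / δ)
  rw [div_lt_iff₀ hδ0] at hn
  induction n generalizing u v with
  | zero => simp at hn; exact absurd hn (not_lt.2 (norm_nonneg _))
  | succ n ih =>
    have hu : L < ‖F φ₀ u‖ := by simpa [vectorComb] using hlt 1 0 (by simp)
    have hv : L < ‖F φ₀ v‖ := by simpa [vectorComb] using hlt 0 1 (by simp)
    have h1 := norm_edge_ge (hF φ₀) h
    have hmu : 2 * ‖F φ₀ u‖ + 2 * δ ≤ ‖F φ₀ u‖ * ‖F φ₀ v‖ - 2 * μ.alpha := by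
      rw [hδ]; nlinarith
    have hmv : 2 * ‖F φ₀ v‖ + 2 * δ ≤ ‖F φ₀ u‖ * ‖F φ₀ v‖ - 2 * μ.alpha := by
      rw [hδ]; nlinarith
    rcases le_or_gt ‖F φ₀ (u - v)‖ ‖F φ₀ (u + v)‖ with hle | hgt
    -- The value ahead exceeds both adjacent ones by at least `δ`, so growth begins with strict
    -- inequalities, which survive perturbation.
    · have e1 : ∀ᶠ φ in 𝓝 φ₀, L < ‖F φ u‖ :=
        continuousAt_const.eventually_lt (hc u).norm.continuousAt hu
      have e2 : ∀ᶠ φ in 𝓝 φ₀, L < ‖F φ v‖ :=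
        continuousAt_const.eventually_lt (hc v).norm.continuousAt hv
      have e3 : ∀ᶠ φ in 𝓝 φ₀, ‖F φ u‖ < ‖F φ (u + v)‖ :=
        (hc u).norm.continuousAt.eventually_lt (hc (u + v)).norm.continuousAt (by linarith)
      have e4 : ∀ᶠ φ in 𝓝 φ₀, ‖F φ v‖ < ‖F φ (u + v)‖ :=
        (hc v).norm.continuousAt.eventually_lt (hc (u + v)).norm.continuousAt (by linarith)
      filter_upwards [e1, e2, e3, e4] with φ h1 h2 h3 h4
      exact goodBeyond_of_growth hL hα (hF φ) h h1 h2 h3.le h4.le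
    · push_cast at hn
      have hl := ih u (u + v) h.left
        (fun a b hab => by rw [vectorComb_left]; exact hlt _ _ (by simpa using hab))
        (by rw [show u - (u + v) = -v by abel, (hF φ₀).neg]; linarith)
      have hr := ih (u + v) v h.right
        (fun a b hab => by rw [vectorComb_right]; exact hlt _ _ (by simpa using hab))
        (by rw [show u + v - v = u by abel]; linarith)
      filter_upwards [hl, hr] with φ h1 h2 using h1.of_children h2

end Growth

/-! ### The Goldman–Toledo map and the degenerate values -/

open Polynomial in
theorem exists_cubic_root (a b c : ℂ) : ∃ t : ℂ, t ^ 3 + a * t ^ 2 + b * t + c = 0 := by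
  have hd : (X ^ 3 + C a * X ^ 2 + C b * X + C c : ℂ[X]).degree = 3 := by compute_degree!
  obtain ⟨t, ht⟩ := IsAlgClosed.exists_root (X ^ 3 + C a * X ^ 2 + C b * X + C c : ℂ[X])
    (by rw [hd]; norm_num)
  exact ⟨t, by simpa [IsRoot] using ht⟩

open Polynomial in
theorem quartic_roots_finite (a b c d : ℂ) :
    {x : ℂ | x ^ 4 + a * x ^ 3 + b * x ^ 2 + c * x + d = 0}.Finite := by
  have hd : (X ^ 4 + C a * X ^ 3 + C b * X ^ 2 + C c * X + C d : ℂ[X]).degree = 4 := by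
    compute_degree!
  have h0 : (X ^ 4 + C a * X ^ 3 + C b * X ^ 2 + C c * X + C d : ℂ[X]) ≠ 0 := by
    intro h; rw [h] at hd; simp at hd
  refine (Polynomial.finite_setOfPred_isRoot h0).subset fun x hx => ?_
  simpa [IsRoot] using hx

/-- Use `σ = a+b+c+d`, `d₁ = a-b+c-d`, `d₂ = a+b-c-d`, `d₃ = a-b-c+d`. The first three equations
become `σ² - dᵢ² = eᵢ`, so `t = σ²` determines all squares. The last one becomes `8σd₁d₂d₃ = 8t² -
g₁t + g₀`; after squaring, the terms in `t⁴` cancel and a cubic with leading coefficient `-4096`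
remains. -/
theorem GT_surjective : Function.Surjective GT := by
  rintro ⟨p, q, r, s⟩
  obtain ⟨e₁, he₁⟩ : ∃ e, e = 4 * (p + q) := ⟨_, rfl⟩
  obtain ⟨e₂, he₂⟩ : ∃ e, e = 4 * (q + r) := ⟨_, rfl⟩
  obtain ⟨e₃, he₃⟩ : ∃ e, e = 4 * (p + r) := ⟨_, rfl⟩
  obtain ⟨g₁, hg₁⟩ : ∃ g, g = 4 * (e₁ + e₂ + e₃) + 256 := ⟨_, rfl⟩
  obtain ⟨g₀, hg₀⟩ : ∃ g, g = 256 * (4 - s + (e₁ + e₂ + e₃) / 4) -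
    (e₁ ^ 2 + e₂ ^ 2 + e₃ ^ 2 - 2 * (e₁ * e₂ + e₂ * e₃ + e₁ * e₃)) := ⟨_, rfl⟩
  obtain ⟨t, ht⟩ := exists_cubic_root
    (-(g₁ ^ 2 + 16 * g₀ - 64 * (e₁ * e₂ + e₂ * e₃ + e₁ * e₃)) / 4096)
    (-(-2 * g₁ * g₀ + 64 * (e₁ * e₂ * e₃)) / 4096) (-g₀ ^ 2 / 4096)
  have hG : (8 * t ^ 2 - g₁ * t + g₀) ^ 2 = 64 * (t * (t - e₁) * (t - e₂) * (t - e₃)) := by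
    linear_combination (-4096) * ht - 16 * t ^ 3 * hg₁
  obtain ⟨σ, hσ⟩ := IsAlgClosed.exists_pow_nat_eq t two_pos
  obtain ⟨d₁, hd₁⟩ := IsAlgClosed.exists_pow_nat_eq (t - e₁) two_pos
  obtain ⟨d₂, hd₂⟩ := IsAlgClosed.exists_pow_nat_eq (t - e₂) two_pos
  obtain ⟨d₃, hd₃, hd⟩ : ∃ d₃, d₃ ^ 2 = t - e₃ ∧
      8 * (σ * d₁ * d₂ * d₃) = 8 * t ^ 2 - g₁ * t + g₀ := by
    obtain ⟨d₃, hd₃⟩ := IsAlgClosed.exists_pow_nat_eq (t - e₃) two_pos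
    have h : (8 * (σ * d₁ * d₂ * d₃)) ^ 2 = (8 * t ^ 2 - g₁ * t + g₀) ^ 2 := by
      rw [hG, ← hd₁, ← hd₂, ← hd₃, ← hσ]; ring
    -- The sign lost by squaring is recovered by the choice of the root `d₃`.
    rcases sq_eq_sq_iff_eq_or_eq_neg.1 h with h | h
    · exact ⟨d₃, hd₃, h⟩
    · exact ⟨-d₃, by rw [← hd₃]; ring, by linear_combination -h⟩
  refine ⟨![(σ + d₁ + d₂ + d₃) / 4, (σ - d₁ + d₂ - d₃) / 4, (σ + d₁ - d₂ - d₃) / 4,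
    (σ - d₁ - d₂ + d₃) / 4], ?_⟩
  ext
  · simp [GT]
    linear_combination hσ / 8 - hd₁ / 8 + hd₂ / 8 - hd₃ / 8 + he₁ / 8 - he₂ / 8 + he₃ / 8
  · simp [GT]
    linear_combination hσ / 8 - hd₁ / 8 - hd₂ / 8 + hd₃ / 8 + he₁ / 8 + he₂ / 8 - he₃ / 8
  · simp [GT]
    linear_combination hσ / 8 + hd₁ / 8 - hd₂ / 8 - hd₃ / 8 - he₁ / 8 + he₂ / 8 + he₃ / 8
  · simp [GT]
    have h4 : σ ^ 4 = t ^ 2 := by rw [← hσ]; ring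
    have k₁ : d₁ ^ 4 = (t - e₁) ^ 2 := by rw [← hd₁]; ring
    have k₂ : d₂ ^ 4 = (t - e₂) ^ 2 := by rw [← hd₂]; ring
    have k₃ : d₃ ^ 4 = (t - e₃) ^ 2 := by rw [← hd₃]; ring
    have l₁ : σ ^ 2 * d₁ ^ 2 = t * (t - e₁) := by rw [hσ, hd₁]
    have l₂ : σ ^ 2 * d₂ ^ 2 = t * (t - e₂) := by rw [hσ, hd₂]
    have l₃ : σ ^ 2 * d₃ ^ 2 = t * (t - e₃) := by rw [hσ, hd₃]
    have m₁ : d₁ ^ 2 * d₂ ^ 2 = (t - e₁) * (t - e₂) := by rw [hd₁, hd₂]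
    have m₂ : d₂ ^ 2 * d₃ ^ 2 = (t - e₂) * (t - e₃) := by rw [hd₂, hd₃]
    have m₃ : d₁ ^ 2 * d₃ ^ 2 = (t - e₁) * (t - e₃) := by rw [hd₁, hd₃]
    linear_combination -(hσ + hd₁ + hd₂ + hd₃) / 4 - (h4 + k₁ + k₂ + k₃) / 256
      + (l₁ + l₂ + l₃ + m₁ + m₂ + m₃) / 128 - hd / 256 - t * hg₁ / 256 * (-1) - hg₀ / 256

/-! ### Degeneration of the conic of a region -/

namespace MarkoffParam

/-- The quartic in `x` which vanishes iff the conic at a region of colour `i` and value `x`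
is degenerate. -/
noncomputable def degenerateQuartic (μ : MarkoffParam) (i j k : Fin 3) (x : ℂ) : ℂ :=
  (x ^ 2 - μ.coeff i * x - μ.s) * (4 - x ^ 2)
    - (μ.coeff j ^ 2 + μ.coeff k ^ 2 - x * μ.coeff j * μ.coeff k)

theorem degenerateQuartic_GT (τ : Fin 4 → ℂ) (x : ℂ) :
    (GT τ).degenerateQuartic 0 1 2 x =
      -(x ^ 2 - τ 0 * τ 1 * x + τ 0 ^ 2 + τ 1 ^ 2 - 4) *
        (x ^ 2 - τ 2 * τ 3 * x + τ 2 ^ 2 + τ 3 ^ 2 - 4) ∧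
    (GT τ).degenerateQuartic 1 0 2 x =
      -(x ^ 2 - τ 0 * τ 3 * x + τ 0 ^ 2 + τ 3 ^ 2 - 4) *
        (x ^ 2 - τ 1 * τ 2 * x + τ 1 ^ 2 + τ 2 ^ 2 - 4) ∧
    (GT τ).degenerateQuartic 2 0 1 x =
      -(x ^ 2 - τ 0 * τ 2 * x + τ 0 ^ 2 + τ 2 ^ 2 - 4) *
        (x ^ 2 - τ 1 * τ 3 * x + τ 1 ^ 2 + τ 3 ^ 2 - 4) := by
  refine ⟨?_, ?_, ?_⟩ <;> simp [degenerateQuartic, GT, coeff] <;> ring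

theorem degenerateQuartic_swap (μ : MarkoffParam) (i j k : Fin 3) (x : ℂ) :
    μ.degenerateQuartic i k j x = μ.degenerateQuartic i j k x := by
  simp only [degenerateQuartic]; ring

/-- Surjectivity of `GT` enters here: over any preimage of `μ` the quartic splits into two of the
quadratics which define the degenerate values. -/
theorem mem_degenerateValues_of_quartic (μ : MarkoffParam) {i j k : Fin 3} (hij : i ≠ j)
    (hik : i ≠ k) (hjk : j ≠ k) {x : ℂ} (hx : μ.degenerateQuartic i j k x = 0) :
    x ∈ μ.degenerateValues := by
  obtain ⟨τ, rfl⟩ := GT_surjective μ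
  obtain ⟨h0, h1, h2⟩ := degenerateQuartic_GT τ x
  have key : ∀ {i j k l : Fin 4} {y : ℂ}, i ≠ j → k ≠ l →
      y = -(x ^ 2 - τ i * τ j * x + τ i ^ 2 + τ j ^ 2 - 4) *
        (x ^ 2 - τ k * τ l * x + τ k ^ 2 + τ l ^ 2 - 4) → y = 0 →
      x ∈ (GT τ).degenerateValues := by
    intro i j k l y hij hkl h h0
    rw [h0, eq_comm, mul_eq_zero, neg_eq_zero] at h
    rcases h with h | h
    · exact ⟨τ, rfl, i, j, hij, h⟩
    · exact ⟨τ, rfl, k, l, hkl, h⟩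
  have h : (GT τ).degenerateQuartic 0 1 2 x = 0 ∨ (GT τ).degenerateQuartic 1 0 2 x = 0 ∨
      (GT τ).degenerateQuartic 2 0 1 x = 0 := by
    have hperm : ∀ i j k : Fin 3, i ≠ j → i ≠ k → j ≠ k →
        (i = 0 ∧ (j = 1 ∧ k = 2 ∨ j = 2 ∧ k = 1)) ∨ (i = 1 ∧ (j = 0 ∧ k = 2 ∨ j = 2 ∧ k = 0)) ∨
          (i = 2 ∧ (j = 0 ∧ k = 1 ∨ j = 1 ∧ k = 0)) := by decide
    clear h0 h1 h2 key
    rcases hperm i j k hij hik hjk with ⟨rfl, ⟨rfl, rfl⟩ | ⟨rfl, rfl⟩⟩ |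
      ⟨rfl, ⟨rfl, rfl⟩ | ⟨rfl, rfl⟩⟩ | ⟨rfl, ⟨rfl, rfl⟩ | ⟨rfl, rfl⟩⟩
    · exact Or.inl hx
    · exact Or.inl (by rwa [degenerateQuartic_swap])
    · exact Or.inr (Or.inl hx)
    · exact Or.inr (Or.inl (by rwa [degenerateQuartic_swap]))
    · exact Or.inr (Or.inr hx)
    · exact Or.inr (Or.inr (by rwa [degenerateQuartic_swap]))
  rcases h with h | h | h
  · exact key (by decide) (by decide) h0 h
  · exact key (by decide) (by decide) h1 h
  · exact key (by decide) (by decide) h2 h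

theorem degenerateQuartic_finite (μ : MarkoffParam) (i j k : Fin 3) :
    {x | μ.degenerateQuartic i j k x = 0}.Finite := by
  refine (quartic_roots_finite (-μ.coeff i) (-μ.s - 4)
    (4 * μ.coeff i - μ.coeff j * μ.coeff k)
    (4 * μ.s + μ.coeff j ^ 2 + μ.coeff k ^ 2)).subset fun x hx => ?_
  simp only [degenerateQuartic, Set.mem_ofPred_eq] at hx ⊢
  linear_combination -hx

/-- Although `τ` runs through a whole fibre of `GT`, each of its quadratics divides one of three
quartics which depend on `μ` alone. -/
theorem degenerateValues_finite (μ : MarkoffParam) : μ.degenerateValues.Finite := by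
  refine (((μ.degenerateQuartic_finite 0 1 2).union (μ.degenerateQuartic_finite 1 0 2)).union
    (μ.degenerateQuartic_finite 2 0 1)).subset ?_
  rintro x ⟨τ, rfl, i, j, hij, h⟩
  obtain ⟨h0, h1, h2⟩ := degenerateQuartic_GT τ x
  simp only [Set.mem_union, Set.mem_ofPred_eq, h0, h1, h2, mul_eq_zero, neg_eq_zero]
  wlog hlt : i < j generalizing i j
  · refine this j i hij.symm ?_ (lt_of_le_of_ne (not_lt.1 hlt) hij.symm)
    linear_combination h
  fin_cases i <;> fin_cases j <;> simp_all

theorem norm_center_le (μ : MarkoffParam) {x : ℂ} (hx : x ∈ μ.degenerateValues) (h2 : x ≠ 2)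
    (h2' : x ≠ -2) {i j : Fin 3} (hij : i ≠ j) :
    ‖(2 * μ.coeff i - x * μ.coeff j) / (4 - x ^ 2)‖ ≤ μ.centerBound := by
  refine le_csSup (Set.Finite.bddAbove ?_) ⟨x, ⟨hx, by simp [h2, h2']⟩, i, j, hij, rfl⟩
  refine ((μ.degenerateValues_finite.prod (Set.finite_univ (α := Fin 3 × Fin 3))).image
    fun q => ‖(2 * μ.coeff q.2.1 - q.1 * μ.coeff q.2.2) / (4 - q.1 ^ 2)‖).subset ?_
  rintro t ⟨x, hx, i, j, -, rfl⟩
  exact ⟨(x, i, j), ⟨hx.1, trivial⟩, rfl⟩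

end MarkoffParam

/-! ### Values along the boundary of a region -/

/-- This is the multiplier of the boundary recurrence: the two roots of `l² + x l + 1` have product
1, so one has modulus at least 1. -/
theorem exists_quadratic_root (x : ℂ) : ∃ l : ℂ, l ≠ 0 ∧ l + l⁻¹ = -x ∧ 1 ≤ ‖l‖ := by
  obtain ⟨d, hd⟩ := IsAlgClosed.exists_pow_nat_eq (x ^ 2 - 4) two_pos
  have h : ((-x + d) / 2) ^ 2 + x * ((-x + d) / 2) + 1 = 0 := by linear_combination hd / 4
  generalize (-x + d) / 2 = l at h
  have hl : l ≠ 0 := by rintro rfl; simp at h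
  have hs : l + l⁻¹ = -x := by field_simp; linear_combination h
  rcases le_total 1 ‖l‖ with h1 | h1
  · exact ⟨l, hl, hs, h1⟩
  · refine ⟨l⁻¹, inv_ne_zero hl, by rw [inv_inv, add_comm, hs], ?_⟩
    rw [norm_inv]
    exact (one_le_inv₀ (norm_pos_iff.2 hl)).2 h1

/-- If `‖l‖ = 1`, then `l⁻¹` is the conjugate of `l`, and `x = -2 Re l` lies in the interval. -/
theorem one_lt_norm_of_notMem_interval22 {x l : ℂ} (h : l + l⁻¹ = -x)
    (h1 : 1 ≤ ‖l‖) (hx : x ∉ interval22) : 1 < ‖l‖ := by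
  refine lt_of_le_of_ne h1 fun h2 => hx ⟨-2 * l.re, ?_, ?_⟩
  · have := abs_le.1 ((Complex.abs_re_le_norm l).trans h2.symm.le)
    constructor <;> linarith [this.1, this.2]
  · have h3 : l⁻¹ = (starRingEnd ℂ) l := by
      rw [Complex.inv_def, Complex.normSq_eq_norm_sq, ← h2]; simp
    have h4 : x = -(l + (starRingEnd ℂ) l) := by rw [← h3, h, neg_neg]
    rw [h4, Complex.add_conj]; push_cast; ring

/-- No branch of a square root is needed, as any choice of the larger root is continuous off the
interval. Indeed `(Λ x - Λ x₀)(Λ x - (Λ x₀)⁻¹) = Λ x (x₀ - x)`, and the second factor has modulus at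
least `‖Λ x‖ (1 - ‖(Λ x₀)⁻¹‖)`, which gives a Lipschitz bound at `x₀`. -/
theorem exists_root_selection : ∃ Λ : ℂ → ℂ, (∀ x, Λ x ≠ 0 ∧ Λ x + (Λ x)⁻¹ = -x) ∧
    ∀ x, x ∉ interval22 → 1 < ‖Λ x‖ ∧ ContinuousAt Λ x := by
  choose Λ h0 hs h1 using exists_quadratic_root
  refine ⟨Λ, fun x => ⟨h0 x, hs x⟩, fun x₀ hx => ?_⟩
  have hlt := one_lt_norm_of_notMem_interval22 (hs x₀) (h1 x₀) hx
  refine ⟨hlt, ?_⟩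
  have hinv : ‖(Λ x₀)⁻¹‖ < 1 := by rw [norm_inv]; exact inv_lt_one_of_one_lt₀ hlt
  have hle : ∀ x, ‖Λ x - Λ x₀‖ ≤ ‖x - x₀‖ / (1 - ‖(Λ x₀)⁻¹‖) := by
    intro x
    rw [le_div_iff₀ (by linarith)]
    have e : (Λ x - Λ x₀) * (Λ x - (Λ x₀)⁻¹) = Λ x * (x₀ - x) := by
      have e1 : Λ x₀ * (Λ x₀)⁻¹ = 1 := mul_inv_cancel₀ (h0 x₀)
      have e2 : Λ x * (Λ x)⁻¹ = 1 := mul_inv_cancel₀ (h0 x)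
      linear_combination e1 - e2 + Λ x * (hs x - hs x₀)
    have e' := congrArg norm e
    rw [norm_mul, norm_mul, norm_sub_rev x₀ x] at e'
    have h2 : ‖Λ x‖ * (1 - ‖(Λ x₀)⁻¹‖) ≤ ‖Λ x - (Λ x₀)⁻¹‖ := by
      nlinarith [norm_sub_norm_le (Λ x) (Λ x₀)⁻¹, h1 x, norm_nonneg (Λ x₀)⁻¹]
    have h3 : ‖Λ x - Λ x₀‖ * (‖Λ x‖ * (1 - ‖(Λ x₀)⁻¹‖)) ≤ ‖Λ x‖ * ‖x - x₀‖ := by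
      rw [← e']; gcongr
    have h4 : 0 < ‖Λ x‖ := norm_pos_iff.2 (h0 x)
    refine le_of_mul_le_mul_left ?_ h4
    linarith
  rw [ContinuousAt, tendsto_iff_norm_sub_tendsto_zero]
  refine squeeze_zero (fun _ => norm_nonneg _) hle ?_
  have : Continuous fun x : ℂ => ‖x - x₀‖ / (1 - ‖(Λ x₀)⁻¹‖) := by fun_prop
  simpa using this.tendsto x₀

theorem linear_recurrence_eq {x l m : ℂ} {z : ℕ → ℂ} (hs : l + m = -x) (hp : l * m = 1)
    (hz : ∀ n, z (n + 2) + x * z (n + 1) + z n = 0) (n : ℕ) :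
    (l - m) * z n = l ^ n * (z 1 - m * z 0) - m ^ n * (z 1 - l * z 0) := by
  induction n using Nat.twoStepInduction with
  | zero => ring
  | one => ring
  | more n h1 h2 =>
    linear_combination (l - m) * hz n - x * h2 - h1
      - (l ^ (n + 1) * (z 1 - m * z 0) - m ^ (n + 1) * (z 1 - l * z 0)) * hs
      + (l ^ n * (z 1 - m * z 0) - m ^ n * (z 1 - l * z 0)) * hp

/-- The recurrence factors as `z (n+2) - m z (n+1) = l (z (n+1) - m z n)`, so the difference stays
zero. -/
theorem linear_recurrence_decay {x l m : ℂ} {z : ℕ → ℂ} (hs : l + m = -x) (hp : l * m = 1)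
    (hz : ∀ n, z (n + 2) + x * z (n + 1) + z n = 0) (h : z 1 = m * z 0) (n : ℕ) :
    z n = m ^ n * z 0 := by
  have key : ∀ n, z (n + 1) = m * z n := by
    intro n
    induction n with
    | zero => exact h
    | succ n ih => linear_combination hz n - z (n + 1) * hs + l * ih + z n * hp
  induction n with
  | zero => simp
  | succ n ih => rw [key, ih]; ring

/-- The regions along the boundary of `u`, starting with `v`. -/
def boundaryVec (u v : ℤ × ℤ) (n : ℕ) : ℤ × ℤ := vectorComb u v n 1

theorem boundaryVec_zero (u v : ℤ × ℤ) : boundaryVec u v 0 = v := by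
  simp [boundaryVec, vectorComb]

theorem boundaryVec_succ (u v : ℤ × ℤ) (n : ℕ) :
    boundaryVec u v (n + 1) = u + boundaryVec u v n := by
  ext <;> simp [boundaryVec, vectorComb] <;> ring

theorem isVectorBasis_boundaryVec {u v : ℤ × ℤ} (h : IsVectorBasis u v) (n : ℕ) :
    IsVectorBasis u (boundaryVec u v n) := by
  induction n with
  | zero => rwa [boundaryVec_zero]
  | succ n ih => rw [boundaryVec_succ]; exact ih.left

theorem vectorColor_boundaryVec (u v : ℤ × ℤ) (n : ℕ) :
    vectorColor (boundaryVec u v (n + 2)) = vectorColor (boundaryVec u v n) := by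
  apply vectorColor_congr <;> simp only [boundaryVec, vectorComb] <;> push_cast <;> ring_nf <;> omega

namespace MarkoffParam

/-- A coordinate of the centre of the conic at a region of value `x`. -/
noncomputable def center (μ : MarkoffParam) (i j : Fin 3) (x : ℂ) : ℂ :=
  (2 * μ.coeff i - x * μ.coeff j) / (4 - x ^ 2)

/-- These are the equations of the critical point of the conic; subtracting the centre removes the
alternating constants from the edge relations along the boundary. -/
theorem center_eq (μ : MarkoffParam) (i j : Fin 3) {x : ℂ} (hx : 4 - x ^ 2 ≠ 0) :
    2 * μ.center i j x + x * μ.center j i x = μ.coeff i := by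
  unfold center; field_simp; ring

end MarkoffParam

theorem ne_two_of_notMem {x : ℂ} (hx : x ∉ interval22) : x ≠ 2 ∧ x ≠ -2 :=
  ⟨fun h => hx ⟨2, by norm_num, by rw [h]; norm_num⟩,
    fun h => hx ⟨-2, by norm_num, by rw [h]; norm_num⟩⟩

theorem four_sub_sq_ne_zero {x : ℂ} (hx : x ∉ interval22) : 4 - x ^ 2 ≠ 0 := by
  obtain ⟨h1, h2⟩ := ne_two_of_notMem hx
  rw [show 4 - x ^ 2 = (2 - x) * (2 + x) by ring]
  exact mul_ne_zero (sub_ne_zero.2 h1.symm) fun h => h2 (by linear_combination h)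

section Boundary

variable {μ : MarkoffParam}

/-- The centred values along the boundary of `u`. -/
noncomputable def boundaryDev (μ : MarkoffParam) (f : ℤ × ℤ → ℂ) (u v : ℤ × ℤ) (n : ℕ) : ℂ :=
  f (boundaryVec u v n) - μ.center (vectorColor (boundaryVec u v n))
    (vectorColor (boundaryVec u v (n + 1))) (f u)

variable {f : ℤ × ℤ → ℂ} (hf : IsVectorMarkoff μ f) {u v : ℤ × ℤ} (h : IsVectorBasis u v)
include hf h

theorem boundaryDev_rec (hx : 4 - f u ^ 2 ≠ 0) (n : ℕ) :
    boundaryDev μ f u v (n + 2) + f u * boundaryDev μ f u v (n + 1) + boundaryDev μ f u v n = 0 := by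
  have h1 := hf.edge_of_basis (isVectorBasis_boundaryVec h (n + 1))
  rw [← boundaryVec_succ, vectorColor_boundaryVec, boundaryVec_succ u v n,
    show u - (u + boundaryVec u v n) = -boundaryVec u v n by abel, hf.neg,
    ← boundaryVec_succ] at h1
  have h2 := μ.center_eq (vectorColor (boundaryVec u v n)) (vectorColor (boundaryVec u v (n + 1))) hx
  simp only [boundaryDev, vectorColor_boundaryVec, show n + 2 + 1 = n + 1 + 2 from rfl,
    show n + 1 + 1 = n + 2 from rfl] at h1 ⊢
  linear_combination h1 - h2

/-- Measured from the centre, the vertex relation sets the form `y² + z² + xyz` equal to a constant.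
The form vanishes on the contracting line `(z, m z)` because `1 + x m + m² = 0`, so the constant is
zero and the conic is degenerate. -/
theorem mem_degenerateValues_of_decay (hx : 4 - f u ^ 2 ≠ 0) {l m : ℂ} (hs : l + m = -f u)
    (hp : l * m = 1) (h0 : boundaryDev μ f u v 1 = m * boundaryDev μ f u v 0) :
    f u ∈ μ.degenerateValues := by
  obtain ⟨n1, n2, n3⟩ := vectorColor_cases h
  refine μ.mem_degenerateValues_of_quartic n1 n2 n3 ?_
  have hv := hf.vertex_of_basis h
  have e0 : boundaryVec u v 0 = v := boundaryVec_zero u v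
  have e1 : boundaryVec u v 1 = u + v := by rw [boundaryVec_succ, e0]
  have e2 : vectorColor (boundaryVec u v (1 + 1)) = vectorColor v := by
    rw [show 1 + 1 = 0 + 2 from rfl, vectorColor_boundaryVec, e0]
  have c0 := μ.center_eq (vectorColor v) (vectorColor (u + v)) hx
  have c1 := μ.center_eq (vectorColor (u + v)) (vectorColor v) hx
  simp only [boundaryDev, e0, e1, e2, zero_add] at h0
  unfold MarkoffParam.degenerateQuartic
  generalize hc : μ.center (vectorColor v) (vectorColor (u + v)) (f u) = a at *
  generalize hd : μ.center (vectorColor (u + v)) (vectorColor v) (f u) = b at *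
  obtain ⟨z, hz⟩ : ∃ z, z = f v - a := ⟨_, rfl⟩
  have hv' : f v = a + z := by rw [hz]; ring
  have hw' : f (u + v) = b + m * z := by rw [hz]; linear_combination h0
  rw [hv', hw'] at hv
  generalize f u = x at *
  generalize μ.coeff (vectorColor v) = k₀ at *
  generalize μ.coeff (vectorColor (u + v)) = k₁ at *
  have q : 1 + m ^ 2 + x * m = 0 := by linear_combination m * hs - hp
  -- This says that the centre itself lies on the conic.
  have E : x ^ 2 - μ.coeff (vectorColor u) * x - μ.s = (k₀ * a + k₁ * b) / 2 := by
    linear_combination hv - z ^ 2 * q - (a / 2 + z) * c0 - (b / 2 + m * z) * c1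
  rw [E]
  linear_combination k₀ / 2 * (2 * c0 - x * c1) + k₁ / 2 * (2 * c1 - x * c0)

/-- If the values along the boundary of `u` do not grow, infinitely many of them are small. -/
theorem exists_norm_boundaryVec_le {L : ℝ} (hM : μ.centerBound + 1 ≤ L) (hx : f u ∉ interval22)
    {l : ℂ} (hl : 1 < ‖l‖) (hs : l + l⁻¹ = -f u)
    (h0 : boundaryDev μ f u v 1 = l⁻¹ * boundaryDev μ f u v 0) :
    ∃ n, ‖f (boundaryVec u v (n + 1))‖ ≤ L := by
  have hl0 : l ≠ 0 := by rintro rfl; simp at hl; linarith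
  have hp : l * l⁻¹ = 1 := mul_inv_cancel₀ hl0
  have hx4 := four_sub_sq_ne_zero hx
  have hS := mem_degenerateValues_of_decay hf h hx4 hs hp h0
  have hd := linear_recurrence_decay hs hp (boundaryDev_rec hf h hx4) h0
  have ht : Tendsto (fun n => l⁻¹ ^ n * boundaryDev μ f u v 0) atTop (𝓝 0) := by
    have := tendsto_pow_atTop_nhds_zero_of_norm_lt_one (x := l⁻¹)
      (by rw [norm_inv]; exact inv_lt_one_of_one_lt₀ hl)
    simpa using this.mul_const (boundaryDev μ f u v 0)
  -- A deviation below 1 suffices, since the coordinates of the centre are at most `L - 1` in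
  -- modulus.
  obtain ⟨n, hn⟩ := ((tendsto_add_atTop_iff_nat 1).2 ht.norm).eventually_lt_const
    (show ‖(0 : ℂ)‖ < 1 by simp) |>.exists
  refine ⟨n, ?_⟩
  rw [← hd] at hn
  have hcol : vectorColor (boundaryVec u v (n + 1)) ≠ vectorColor (boundaryVec u v (n + 1 + 1)) := by
    rw [boundaryVec_succ u v (n + 1)]
    exact (vectorColor_cases (isVectorBasis_boundaryVec h (n + 1))).2.2
  have hc := μ.norm_center_le hS (ne_two_of_notMem hx).1 (ne_two_of_notMem hx).2 hcol
  have : f (boundaryVec u v (n + 1)) = boundaryDev μ f u v (n + 1) +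
      μ.center (vectorColor (boundaryVec u v (n + 1)))
        (vectorColor (boundaryVec u v (n + 1 + 1))) (f u) := by
    simp [boundaryDev]
  rw [this]
  refine (norm_add_le _ _).trans ?_
  unfold MarkoffParam.center
  linarith

end Boundary

/-! ### Uniform growth along a boundary, and stability of good edges -/

section BoundaryGrowth

variable {μ : MarkoffParam} {Φ : Type*} [TopologicalSpace Φ] {F : Φ → ℤ × ℤ → ℂ}

/-- Locally uniform growth of the values along the boundary of a region. -/
theorem eventually_lt_norm_boundaryVec {L : ℝ} (hM : μ.centerBound + 1 ≤ L)
    (hF : ∀ φ, IsVectorMarkoff μ (F φ)) (hc : ∀ u, Continuous fun φ => F φ u) (φ₀ : Φ)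
    {u v : ℤ × ℤ} (h : IsVectorBasis u v) (hx : F φ₀ u ∉ interval22)
    (hlt : ∀ n, L < ‖F φ₀ (boundaryVec u v (n + 1))‖) (K : ℝ) :
    ∃ N, ∀ᶠ φ in 𝓝 φ₀, ∀ n, N ≤ n → K < ‖F φ (boundaryVec u v n)‖ := by
  obtain ⟨Λ, hΛ, hΛc⟩ := exists_root_selection
  obtain ⟨hΛ1, hΛcont⟩ := hΛc _ hx
  have hcu : ContinuousAt (fun φ => F φ u) φ₀ := (hc u).continuousAt
  have hx4 := four_sub_sq_ne_zero hx
  have hl : ContinuousAt (fun φ => Λ (F φ u)) φ₀ := hΛcont.comp_of_eq hcu rfl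
  have hcen : ∀ i j, ContinuousAt (fun φ => μ.center i j (F φ u)) φ₀ := fun i j => by
    unfold MarkoffParam.center
    exact ContinuousAt.div (by fun_prop) (by fun_prop) hx4
  have hdev : ∀ n, ContinuousAt (fun φ => boundaryDev μ (F φ) u v n) φ₀ := fun n => by
    unfold boundaryDev
    exact (hc _).continuousAt.sub (hcen _ _)
  have hlinv : ContinuousAt (fun φ => (Λ (F φ u))⁻¹) φ₀ := hl.inv₀ (hΛ _).1
  set V : Φ → ℂ := fun φ =>
    boundaryDev μ (F φ) u v 1 - (Λ (F φ u))⁻¹ * boundaryDev μ (F φ) u v 0 with hV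
  set W : Φ → ℂ := fun φ =>
    boundaryDev μ (F φ) u v 1 - Λ (F φ u) * boundaryDev μ (F φ) u v 0 with hW
  have hVc : ContinuousAt V φ₀ := (hdev 1).sub (hlinv.mul (hdev 0))
  have hWc : ContinuousAt W φ₀ := (hdev 1).sub (hl.mul (hdev 0))
  have hDc : ContinuousAt (fun φ => Λ (F φ u) - (Λ (F φ u))⁻¹) φ₀ := hl.sub hlinv
  -- `V` is the coefficient of the expanding solution; if it vanished, some boundary value would be
  -- at most `L`.
  have hV0 : V φ₀ ≠ 0 := by
    intro h0
    obtain ⟨n, hn⟩ := exists_norm_boundaryVec_le (hF φ₀) h hM hx hΛ1 (hΛ _).2 (sub_eq_zero.1 h0)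
    exact absurd (hlt n) (not_lt.2 hn)
  have hV0' : 0 < ‖V φ₀‖ := norm_pos_iff.2 hV0
  have e1 : ∀ᶠ φ in 𝓝 φ₀, ‖V φ₀‖ / 2 < ‖V φ‖ :=
    continuousAt_const.eventually_lt hVc.norm (by linarith)
  have e2 : ∀ᶠ φ in 𝓝 φ₀, ‖W φ‖ < ‖W φ₀‖ + 1 :=
    hWc.norm.eventually_lt continuousAt_const (by linarith)
  obtain ⟨d, hd⟩ : ∃ d, d = ‖Λ (F φ₀ u) - (Λ (F φ₀ u))⁻¹‖ + 1 := ⟨_, rfl⟩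
  have e3 : ∀ᶠ φ in 𝓝 φ₀, ‖Λ (F φ u) - (Λ (F φ u))⁻¹‖ < d :=
    hDc.norm.eventually_lt continuousAt_const (by linarith)
  have hd0 : 0 < d := by rw [hd]; positivity
  obtain ⟨ℓ, hℓ⟩ : ∃ ℓ, ℓ = (1 + ‖Λ (F φ₀ u)‖) / 2 := ⟨_, rfl⟩
  have hℓ1 : 1 < ℓ := by linarith
  have e4 : ∀ᶠ φ in 𝓝 φ₀, ℓ < ‖Λ (F φ u)‖ :=
    continuousAt_const.eventually_lt hl.norm (by linarith)
  have e5 : ∀ᶠ φ in 𝓝 φ₀, ∀ i j, ‖μ.center i j (F φ u)‖ < ‖μ.center i j (F φ₀ u)‖ + 1 :=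
    eventually_all.2 fun i => eventually_all.2 fun j =>
      (hcen i j).norm.eventually_lt continuousAt_const (by linarith)
  obtain ⟨C, hC⟩ := (Set.finite_range fun q : Fin 3 × Fin 3 =>
    ‖μ.center q.1 q.2 (F φ₀ u)‖ + 1).bddAbove
  -- From `N` on, the expanding term beats the contracting one by `d (K + C)`, where `d` bounds the
  -- factor `Λ - Λ⁻¹` and `C` the coordinates of the centre.
  obtain ⟨N, hN⟩ := pow_unbounded_of_one_lt ((d * (K + C) + (‖W φ₀‖ + 1)) / (‖V φ₀‖ / 2)) hℓ1
  rw [div_lt_iff₀ (by linarith)] at hN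
  refine ⟨N, ?_⟩
  have e6 : ∀ᶠ φ in 𝓝 φ₀, 4 - F φ u ^ 2 ≠ 0 :=
    ContinuousAt.eventually_ne (by fun_prop) hx4
  filter_upwards [e1, e2, e3, e4, e5, e6] with φ h1 h2 h3 h4 h5 h6 n hn
  have hp : Λ (F φ u) * (Λ (F φ u))⁻¹ = 1 := mul_inv_cancel₀ (hΛ _).1
  have hrec := linear_recurrence_eq (hΛ (F φ u)).2 hp (boundaryDev_rec (hF φ) h h6) n
  have hr1 : ‖(Λ (F φ u))⁻¹ ^ n‖ ≤ 1 := by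
    rw [norm_pow, norm_inv]
    exact pow_le_one₀ (by positivity) (inv_le_one_of_one_le₀ (by linarith))
  have hr2 : ℓ ^ N ≤ ‖Λ (F φ u) ^ n‖ := by
    rw [norm_pow]
    exact (pow_le_pow_right₀ hℓ1.le hn).trans (pow_le_pow_left₀ (by linarith) h4.le n)
  have hr3 := norm_sub_norm_le (Λ (F φ u) ^ n * V φ) ((Λ (F φ u))⁻¹ ^ n * W φ)
  rw [show Λ (F φ u) ^ n * V φ - (Λ (F φ u))⁻¹ ^ n * W φ = _ from hrec.symm] at hr3
  rw [norm_mul, norm_mul, norm_mul] at hr3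
  have hr4 : ℓ ^ N * (‖V φ₀‖ / 2) ≤ ‖Λ (F φ u) ^ n‖ * ‖V φ‖ := by gcongr
  have hr5 : ‖(Λ (F φ u))⁻¹ ^ n‖ * ‖W φ‖ ≤ ‖W φ₀‖ + 1 := by
    nlinarith [norm_nonneg (W φ)]
  have hr6 : ‖Λ (F φ u) - (Λ (F φ u))⁻¹‖ * ‖boundaryDev μ (F φ) u v n‖ ≤
      d * ‖boundaryDev μ (F φ) u v n‖ := by gcongr
  have hr7 : d * (K + C) < d * ‖boundaryDev μ (F φ) u v n‖ := by linarith
  have hr8 := lt_of_mul_lt_mul_left hr7 hd0.le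
  have hr9 := (h5 (vectorColor (boundaryVec u v n)) (vectorColor (boundaryVec u v (n + 1)))).le.trans
    (hC ⟨(vectorColor (boundaryVec u v n), vectorColor (boundaryVec u v (n + 1))), rfl⟩)
  have hr10 := norm_sub_le (F φ (boundaryVec u v n))
    (μ.center (vectorColor (boundaryVec u v n)) (vectorColor (boundaryVec u v (n + 1))) (F φ u))
  change ‖boundaryDev μ (F φ) u v n‖ ≤ _ at hr10
  linarith

theorem vectorComb_boundaryVec (u v : ℤ × ℤ) (n a b : ℕ) :
    vectorComb u (boundaryVec u v n) a b = vectorComb u v (a + n * b) b := by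
  ext <;> simp [boundaryVec, vectorComb] <;> ring

/-- Every region beyond `u, boundaryVec u v n` other than `u` lies beyond a side edge of the
boundary of `u`: while `a ≥ b`, trade `b` copies of `u` for one step along the boundary. -/
theorem lt_norm_beyond_boundary {L : ℝ} {f : ℤ × ℤ → ℂ} {u v : ℤ × ℤ} {N : ℕ}
    (hside : ∀ n, N ≤ n → ∀ a b : ℕ, a.Coprime b →
      L < ‖f (vectorComb (u + boundaryVec u v n) (boundaryVec u v n) a b)‖)
    (a b : ℕ) (hb : b ≠ 0) (hab : a.Coprime b) :
    ∀ n, N ≤ n → L < ‖f (vectorComb u (boundaryVec u v n) a b)‖ := by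
  induction a using Nat.strong_induction_on with
  | _ a ih =>
    intro n hn
    rcases lt_or_ge a b with h | h
    · obtain ⟨c, rfl⟩ := Nat.exists_eq_add_of_le h.le
      rw [← vectorComb_right]
      exact hside n hn a c (by simpa using hab)
    · obtain ⟨c, rfl⟩ := Nat.exists_eq_add_of_le' h
      rw [← vectorComb_left, ← boundaryVec_succ]
      exact ih c (by omega) (by simpa using hab) (n + 1) (by omega)

theorem eventually_goodBeyond_boundaryVec {L : ℝ} (hL : 2 < L) (hα : 2 + μ.alpha ≤ L)
    (hM : μ.centerBound + 1 ≤ L)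
    (hF : ∀ φ, IsVectorMarkoff μ (F φ)) (hc : ∀ u, Continuous fun φ => F φ u) (φ₀ : Φ)
    {u v : ℤ × ℤ} (h : IsVectorBasis u v) (hx : F φ₀ u ∉ interval22)
    (hlt : ∀ n, L < ‖F φ₀ (boundaryVec u v (n + 1))‖) :
    ∃ N, ∀ᶠ φ in 𝓝 φ₀, GoodBeyond L (F φ) u (boundaryVec u v (N + 1)) := by
  have hα0 := μ.alpha_nonneg
  -- The region behind a side edge is `u`. Boundary values of this size outweigh it and the
  -- coefficient, so growth starts at each side edge, uniformly in `n` and `φ`.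
  obtain ⟨N, hN⟩ := eventually_lt_norm_boundaryVec hM hF hc φ₀ h hx hlt
    (L + ‖F φ₀ u‖ + 2 * μ.alpha + 2)
  refine ⟨N, ?_⟩
  have hclosed : IsClosed interval22 :=
    (isCompact_Icc.image Complex.continuous_ofReal).isClosed
  have e1 : ∀ᶠ φ in 𝓝 φ₀, F φ u ∉ interval22 :=
    (hc u).continuousAt.eventually (hclosed.isOpen_compl.mem_nhds hx)
  have e2 : ∀ᶠ φ in 𝓝 φ₀, ‖F φ u‖ < ‖F φ₀ u‖ + 1 :=
    (hc u).norm.continuousAt.eventually_lt continuousAt_const (by linarith)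
  filter_upwards [hN, e1, e2] with φ h1 h2 h3
  have hside : ∀ n, N ≤ n → ∀ a b : ℕ, a.Coprime b →
      L < ‖F φ (vectorComb (u + boundaryVec u v n) (boundaryVec u v n) a b)‖ := by
    intro n hn a b hab
    have k1 := h1 n hn
    have k2 := h1 (n + 1) (by omega)
    rw [boundaryVec_succ] at k2
    have hb := (isVectorBasis_boundaryVec h n).right
    have k3 := norm_edge_ge (hF φ) hb
    rw [show u + boundaryVec u v n - boundaryVec u v n = u by abel] at k3
    have n0 := norm_nonneg (F φ₀ u)
    refine lt_norm_of_growth hL hα (hF φ) _ hb (by linarith) (by linarith) ?_ ?_ a b le_rfl hab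
    · nlinarith
    · nlinarith
  have hbig := lt_norm_beyond_boundary hside
  refine ⟨fun a b hab => ?_, (Set.finite_singleton (1, 0)).subset ?_⟩
  · rcases eq_or_ne b 0 with rfl | hb
    · obtain rfl : a = 1 := by simpa using hab
      simpa [vectorComb] using h2
    · intro hm
      linarith [hbig a b hb hab (N + 1) (by omega), norm_le_two_of_mem_interval22 hm]
  · rintro ⟨a, b⟩ ⟨hab, hle⟩
    rcases eq_or_ne b 0 with rfl | hb
    · obtain rfl : a = 1 := by simpa using hab
      rfl
    · exact absurd (hbig a b hb hab (N + 1) (by omega)) (not_lt.2 hle)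

theorem coprime_add_mul {a b : ℕ} (n : ℕ) (h : a.Coprime b) : (a + n * (a + b)).Coprime (a + b) := by
  simpa using h

/-- An edge beyond which at most the two adjacent regions are small stays good under
perturbation. -/
theorem eventually_goodBeyond_left {L : ℝ} (hL : 2 < L) (hα : 2 + μ.alpha ≤ L)
    (hM : μ.centerBound + 1 ≤ L)
    (hF : ∀ φ, IsVectorMarkoff μ (F φ)) (hc : ∀ u, Continuous fun φ => F φ u) (φ₀ : Φ)
    {u v : ℤ × ℤ} (h : IsVectorBasis u v) (hx : F φ₀ u ∉ interval22)
    (hlt : ∀ a b : ℕ, a.Coprime b → 1 < a + b → L < ‖F φ₀ (vectorComb u v a b)‖) :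
    ∀ᶠ φ in 𝓝 φ₀, GoodBeyond L (F φ) u (u + v) := by
  obtain ⟨N, hN⟩ := eventually_goodBeyond_boundaryVec hL hα hM hF hc φ₀ h hx
    (fun n => hlt (n + 1) 1 (by simp) (by omega))
  -- Return along the boundary one side edge at a time. The side edges start at `boundaryVec u v 1`,
  -- not at `v`, since `v` may be small; hence the conclusion about `u, u + v`.
  have step : ∀ n, (∀ᶠ φ in 𝓝 φ₀, GoodBeyond L (F φ) u (boundaryVec u v (n + 2))) →
      ∀ᶠ φ in 𝓝 φ₀, GoodBeyond L (F φ) u (boundaryVec u v (n + 1)) := by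
    intro n hn
    have hside := eventually_goodBeyond_of_lt hL hα hF hc φ₀ _ _
      (isVectorBasis_boundaryVec h (n + 1)).right (fun a b hab => by
        rw [vectorComb_right, vectorComb_boundaryVec]
        have hs : a + b ≠ 0 := by
          rintro h0
          obtain ⟨rfl, rfl⟩ : a = 0 ∧ b = 0 := by omega
          simp at hab
        have := Nat.pos_of_ne_zero hs
        refine hlt _ _ (coprime_add_mul _ hab) ?_
        nlinarith [Nat.zero_le (n * (a + b)), Nat.zero_le a])
    filter_upwards [hn, hside] with φ h1 h2
    rw [boundaryVec_succ u v (n + 1)] at h1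
    exact h1.of_children h2
  have hdown : ∀ᶠ φ in 𝓝 φ₀, GoodBeyond L (F φ) u (boundaryVec u v (0 + 1)) := by
    induction N with
    | zero => exact hN
    | succ N ih => exact ih (step N hN)
  rwa [zero_add, boundaryVec_succ, boundaryVec_zero] at hdown

/-- If all small regions beyond an edge have bounded coordinates, the edge stays good under
perturbation. -/
theorem eventually_goodBeyond_of_bound {L : ℝ} (hL : 2 < L) (hα : 2 + μ.alpha ≤ L)
    (hM : μ.centerBound + 1 ≤ L)
    (hF : ∀ φ, IsVectorMarkoff μ (F φ)) (hc : ∀ u, Continuous fun φ => F φ u) (φ₀ : Φ) (K : ℕ) :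
    ∀ {u v : ℤ × ℤ}, IsVectorBasis u v →
      (∀ a b : ℕ, a.Coprime b → F φ₀ (vectorComb u v a b) ∉ interval22) →
      (∀ a b : ℕ, a.Coprime b → K + 1 < a + b → L < ‖F φ₀ (vectorComb u v a b)‖) →
      ∀ᶠ φ in 𝓝 φ₀, GoodBeyond L (F φ) u v := by
  induction K with
  | zero =>
    intro u v h hI hlt
    rw [zero_add] at hlt
    have h1 := eventually_goodBeyond_left hL hα hM hF hc φ₀ h
      (by simpa [vectorComb] using hI 1 0 (by simp)) hlt
    have h2 := eventually_goodBeyond_left hL hα hM hF hc φ₀ h.swap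
      (by simpa [vectorComb] using hI 0 1 (by simp))
      (fun a b hab hs => by rw [vectorComb_swap]; exact hlt b a hab.symm (by omega))
    rw [add_comm v u] at h2
    filter_upwards [h1, h2] with φ k1 k2 using k1.of_children k2.swap
  | succ K ih =>
    intro u v h hI hlt
    have h1 : ∀ᶠ φ in 𝓝 φ₀, GoodBeyond L (F φ) u (u + v) := by
      refine ih h.left (fun a b hab => ?_) (fun a b hab hs => ?_) <;> rw [vectorComb_left]
      · exact hI _ _ (by simpa using hab)
      -- With `b = 0` the only coordinates are `(1, 0)`, which the bound excludes; otherwise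
      -- rewriting in the basis `u, v` raises the coordinate sum by `b ≥ 1`.
      · rcases Nat.eq_zero_or_pos b with rfl | hb
        · have : a = 1 := by simpa using hab
          omega
        · exact hlt _ _ (by simpa using hab) (by omega)
    have h2 : ∀ᶠ φ in 𝓝 φ₀, GoodBeyond L (F φ) (u + v) v := by
      refine ih h.right (fun a b hab => ?_) (fun a b hab hs => ?_) <;> rw [vectorComb_right]
      · exact hI _ _ (by simpa using hab)
      · rcases Nat.eq_zero_or_pos a with rfl | ha
        · have : b = 1 := by simpa using hab
          omega
        · exact hlt _ _ (by simpa using hab) (by omega)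
    filter_upwards [h1, h2] with φ k1 k2 using k1.of_children k2

/-- The BQ-conditions for a function on integral vectors. -/
def IsVectorBowditch (L : ℝ) (f : ℤ × ℤ → ℂ) : Prop :=
  (∀ u : ℤ × ℤ, IsCoprime u.1 u.2 → f u ∉ interval22) ∧
  {u : ℤ × ℤ | IsCoprime u.1 u.2 ∧ ‖f u‖ ≤ L}.Finite

theorem vectorComb_pos (a b : ℕ) : vectorComb (1, 0) (0, 1) a b = ((a : ℤ), (b : ℤ)) := by
  simp [vectorComb]

theorem vectorComb_neg (a b : ℕ) : vectorComb (-1, 0) (0, 1) a b = (-(a : ℤ), (b : ℤ)) := by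
  simp [vectorComb]

/-- The two sectors and their negatives cover all primitive vectors. -/
theorem IsVectorBowditch.of_goodBeyond {L : ℝ} {f : ℤ × ℤ → ℂ} (hneg : ∀ u, f (-u) = f u)
    (h1 : GoodBeyond L f (1, 0) (0, 1)) (h2 : GoodBeyond L f (-1, 0) (0, 1)) :
    IsVectorBowditch L f := by
  have key : ∀ u : ℤ × ℤ, IsCoprime u.1 u.2 → ∃ a b : ℕ, a.Coprime b ∧
      ((u = ((a : ℤ), (b : ℤ)) ∨ u = -((a : ℤ), (b : ℤ))) ∨
        (u = (-(a : ℤ), (b : ℤ)) ∨ u = -(-(a : ℤ), (b : ℤ)))) := by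
    rintro ⟨x, y⟩ hxy
    refine ⟨x.natAbs, y.natAbs, Int.isCoprime_iff_gcd_eq_one.1 hxy, ?_⟩
    simp only [Prod.mk.injEq, Prod.neg_mk]
    omega
  constructor
  · intro u hu
    obtain ⟨a, b, hab, (rfl | rfl) | (rfl | rfl)⟩ := key u hu
    · rw [← vectorComb_pos]; exact h1.1 a b hab
    · rw [hneg, ← vectorComb_pos]; exact h1.1 a b hab
    · rw [← vectorComb_neg]; exact h2.1 a b hab
    · rw [hneg, ← vectorComb_neg]; exact h2.1 a b hab
  · refine (((h1.2.image fun q => vectorComb (1, 0) (0, 1) q.1 q.2).union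
      (h1.2.image fun q => -vectorComb (1, 0) (0, 1) q.1 q.2)).union
      ((h2.2.image fun q => vectorComb (-1, 0) (0, 1) q.1 q.2).union
      (h2.2.image fun q => -vectorComb (-1, 0) (0, 1) q.1 q.2))).subset ?_
    rintro u ⟨hu, hle⟩
    obtain ⟨a, b, hab, (rfl | rfl) | (rfl | rfl)⟩ := key u hu
    · rw [← vectorComb_pos] at hle ⊢
      exact Or.inl (Or.inl ⟨(a, b), ⟨hab, hle⟩, rfl⟩)
    · rw [← vectorComb_pos] at hle ⊢
      rw [hneg] at hle
      exact Or.inl (Or.inr ⟨(a, b), ⟨hab, hle⟩, rfl⟩)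
    · rw [← vectorComb_neg] at hle ⊢
      exact Or.inr (Or.inl ⟨(a, b), ⟨hab, hle⟩, rfl⟩)
    · rw [← vectorComb_neg] at hle ⊢
      rw [hneg] at hle
      exact Or.inr (Or.inr ⟨(a, b), ⟨hab, hle⟩, rfl⟩)

/-- The BQ-conditions are open in any continuous family of Markoff functions. -/
theorem isOpen_isVectorBowditch {L : ℝ} (hL : 2 < L) (hα : 2 + μ.alpha ≤ L)
    (hM : μ.centerBound + 1 ≤ L)
    (hF : ∀ φ, IsVectorMarkoff μ (F φ)) (hc : ∀ u, Continuous fun φ => F φ u) :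
    IsOpen {φ | IsVectorBowditch L (F φ)} := by
  rw [isOpen_iff_eventually]
  rintro φ₀ ⟨hI, hfin⟩
  obtain ⟨K, hK⟩ := (hfin.image fun u => u.1.natAbs + u.2.natAbs).bddAbove
  have hlt : ∀ u : ℤ × ℤ, IsCoprime u.1 u.2 → K < u.1.natAbs + u.2.natAbs → L < ‖F φ₀ u‖ := by
    intro u hu hs
    by_contra hle
    exact absurd (hK ⟨u, ⟨hu, not_lt.1 hle⟩, rfl⟩) (not_le.2 hs)
  have h1 := eventually_goodBeyond_of_bound hL hα hM hF hc φ₀ K (u := (1, 0)) (v := (0, 1))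
    (by left; simp [vectorDet])
    (fun a b hab => by
      rw [vectorComb_pos]; exact hI _ (Nat.isCoprime_iff_coprime.2 hab))
    (fun a b hab hs => by
      rw [vectorComb_pos]
      exact hlt _ (Nat.isCoprime_iff_coprime.2 hab) (by simp; omega))
  have h2 := eventually_goodBeyond_of_bound hL hα hM hF hc φ₀ K (u := (-1, 0)) (v := (0, 1))
    (by right; simp [vectorDet])
    (fun a b hab => by
      rw [vectorComb_neg]; exact hI _ (Nat.isCoprime_iff_coprime.2 hab).neg_left)
    (fun a b hab hs => by
      rw [vectorComb_neg]
      exact hlt _ (Nat.isCoprime_iff_coprime.2 hab).neg_left (by simp; omega))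
  filter_upwards [h1, h2] with φ k1 k2
  exact IsVectorBowditch.of_goodBeyond (hF φ).neg k1 k2

end BoundaryGrowth

/-! ### Regions as primitive vectors up to sign -/

namespace Region

/-- The region whose slope is the ratio of the entries of a vector. -/
def ofVector (u : ℤ × ℤ) : Region :=
  if u.2 = 0 then OnePoint.infty else ((u.1 / u.2 : ℚ) : OnePoint ℚ)

theorem ofVector_neg (u : ℤ × ℤ) : ofVector (-u) = ofVector u := by
  simp [ofVector, neg_div_neg_eq]

/-- The slope of a region in lowest terms, as a vector. -/
def toVector (X : Region) : ℤ × ℤ := (X.num, X.den)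

theorem isCoprime_toVector (X : Region) : IsCoprime X.toVector.1 X.toVector.2 := by
  induction X using OnePoint.rec with
  | infty => exact isCoprime_one_left
  | coe x => exact Int.isCoprime_iff_gcd_eq_one.2 x.reduced

theorem ofVector_toVector (X : Region) : ofVector X.toVector = X := by
  induction X using OnePoint.rec with
  | infty => rfl
  | coe x =>
    have h : toVector (x : OnePoint ℚ) = (x.num, (x.den : ℤ)) := rfl
    rw [h, ofVector, if_neg (by simp)]
    congr 1
    simpa using Rat.num_div_den x

theorem toVector_ofVector {u : ℤ × ℤ} (hu : IsCoprime u.1 u.2) :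
    (ofVector u).toVector = u ∨ (ofVector u).toVector = -u := by
  wlog h : 0 ≤ u.2 generalizing u
  · have := this (u := -u) hu.neg_neg (by simp; omega)
    rw [ofVector_neg, neg_neg] at this
    exact this.symm
  obtain ⟨a, b⟩ := u
  rcases h.eq_or_lt with h | h
  · obtain rfl : b = 0 := h.symm
    have ha : a = 1 ∨ a = -1 := Int.isUnit_iff.1 (isCoprime_zero_right.1 hu)
    have e : (ofVector (a, 0)).toVector = (1, 0) := by simp [ofVector]; rfl
    rw [e]
    rcases ha with rfl | rfl <;> simp
  · left
    have hb : b ≠ 0 := ne_of_gt h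
    have hc := Int.isCoprime_iff_gcd_eq_one.1 hu
    have e : (ofVector (a, b)).toVector = (((a / b : ℚ)).num, (((a / b : ℚ)).den : ℤ)) := by
      simp only [ofVector, if_neg hb]; rfl
    rw [e, Rat.num_div_eq_of_coprime h hc, Rat.den_div_eq_of_coprime h hc]

theorem color_eq_vectorColor (X : Region) : X.color = (vectorColor X.toVector : ℕ) + 1 := by
  simp only [color, vectorColor, toVector]
  by_cases h1 : X.num % 2 = 0 <;> by_cases h2 : X.den % 2 = 0 <;>
    simp only [h1, h2, if_true, if_false] <;> rfl

theorem color_ofVector {u : ℤ × ℤ} (hu : IsCoprime u.1 u.2) :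
    (ofVector u).color = (vectorColor u : ℕ) + 1 := by
  rw [color_eq_vectorColor]
  rcases toVector_ofVector hu with h | h <;> rw [h]
  rw [vectorColor_neg]

theorem adj_iff (X Y : Region) : X.Adj Y ↔ IsVectorBasis X.toVector Y.toVector := by
  unfold Adj IsVectorBasis vectorDet toVector
  rw [abs_eq zero_le_one]

theorem Adj.symm {X Y : Region} (h : X.Adj Y) : Y.Adj X := by
  rw [adj_iff] at *; exact h.swap

end Region

theorem IsVectorBasis.neg_left {u v : ℤ × ℤ} (h : IsVectorBasis u v) : IsVectorBasis (-u) v := by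
  unfold IsVectorBasis vectorDet at *
  simp only [Prod.fst_neg, Prod.snd_neg]
  rcases h with h | h
  · right; linarith
  · left; linarith

theorem IsVectorBasis.neg_right {u v : ℤ × ℤ} (h : IsVectorBasis u v) : IsVectorBasis u (-v) :=
  h.swap.neg_left.swap

theorem IsVectorBasis.isCoprime {u v : ℤ × ℤ} (h : IsVectorBasis u v) : IsCoprime u.1 u.2 := by
  unfold IsVectorBasis vectorDet at h
  rcases h with h | h
  · exact ⟨v.2, -v.1, by linear_combination h⟩
  · exact ⟨-v.2, v.1, by linear_combination -h⟩

namespace Region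

theorem adj_ofVector {u v : ℤ × ℤ} (h : IsVectorBasis u v) : (ofVector u).Adj (ofVector v) := by
  rw [adj_iff]
  rcases toVector_ofVector h.isCoprime with h1 | h1 <;>
  rcases toVector_ofVector h.swap.isCoprime with h2 | h2 <;> rw [h1, h2]
  · exact h
  · exact h.neg_right
  · exact h.neg_left
  · exact h.neg_left.neg_right

theorem isVertex_ofVector {u v : ℤ × ℤ} (h : IsVectorBasis u v) :
    IsVertex (ofVector u) (ofVector v) (ofVector (u + v)) :=
  ⟨adj_ofVector h, adj_ofVector h.right.swap, adj_ofVector h.left⟩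

theorem IsVertex.swap {X Y Z : Region} (h : IsVertex X Y Z) : IsVertex Y X Z :=
  ⟨h.1.symm, h.2.2, h.2.1⟩

theorem IsVertex.rotate {X Y Z : Region} (h : IsVertex X Y Z) : IsVertex Y Z X :=
  ⟨h.2.1, h.2.2.symm, h.1.symm⟩

theorem IsEdge.swap {X Y Z W : Region} (h : IsEdge X Y Z W) : IsEdge Y X Z W :=
  ⟨h.1.swap, h.2.1.swap, h.2.2⟩

theorem IsEdge.symm_ends {X Y Z W : Region} (h : IsEdge X Y Z W) : IsEdge X Y W Z :=
  ⟨h.2.1, h.1, h.2.2.symm⟩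

theorem vectorDet_eq_zero {u v : ℤ × ℤ} (hu : IsCoprime u.1 u.2) (hv : IsCoprime v.1 v.2)
    (h : ofVector u = ofVector v) : vectorDet u v = 0 := by
  have h' := congrArg toVector h
  rcases toVector_ofVector hu with h1 | h1 <;> rcases toVector_ofVector hv with h2 | h2 <;>
    rw [h1, h2] at h'
  · rw [h']; simp [vectorDet]; ring
  · rw [h']; simp [vectorDet]; ring
  · rw [← h']; simp [vectorDet]; ring
  · rw [neg_injective h']; simp [vectorDet]; ring

/-- The ends differ because `u + v` and `u - v` have determinant `±2`. -/
theorem isEdge_ofVector {u v : ℤ × ℤ} (h : IsVectorBasis u v) :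
    IsEdge (ofVector u) (ofVector v) (ofVector (u + v)) (ofVector (u - v)) := by
  refine ⟨isVertex_ofVector h, ?_, fun he => ?_⟩
  · have := isVertex_ofVector h.neg_right
    rwa [ofVector_neg, ← sub_eq_add_neg] at this
  · have hs := h.neg_right.left.swap.isCoprime
    rw [← sub_eq_add_neg] at hs
    have := vectorDet_eq_zero h.left.swap.isCoprime hs he
    unfold IsVectorBasis at h
    simp only [vectorDet, Prod.fst_add, Prod.fst_sub, Prod.snd_add, Prod.snd_sub] at *
    rcases h with h | h <;> linarith

/-- By Cramer's rule with all three determinants `±1`, the vector of `Z` is a signed sum of the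
other two; signs are absorbed into the basis. -/
theorem IsVertex.exists_basis {X Y Z : Region} (h : IsVertex X Y Z) :
    ∃ u v, IsVectorBasis u v ∧ ofVector u = X ∧ ofVector v = Y ∧ ofVector (u + v) = Z := by
  obtain ⟨h1, h2, h3⟩ := h
  rw [adj_iff] at h1 h2 h3
  have key : Z.toVector = X.toVector + Y.toVector ∨ Z.toVector = -(X.toVector + Y.toVector) ∨
      Z.toVector = X.toVector + -Y.toVector ∨ Z.toVector = -(X.toVector + -Y.toVector) := by
    generalize X.toVector = x at *
    generalize Y.toVector = y at *
    generalize Z.toVector = z at *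
    obtain ⟨x1, x2⟩ := x
    obtain ⟨y1, y2⟩ := y
    obtain ⟨z1, z2⟩ := z
    simp only [IsVectorBasis, vectorDet, Prod.mk_add_mk, Prod.neg_mk, Prod.mk.injEq] at *
    have e1 : (x1 * y2 - x2 * y1) * z1 = (z1 * y2 - z2 * y1) * x1 + (x1 * z2 - x2 * z1) * y1 := by
      ring
    have e2 : (x1 * y2 - x2 * y1) * z2 = (z1 * y2 - z2 * y1) * x2 + (x1 * z2 - x2 * z1) * y2 := by
      ring
    rw [show z1 * y2 - z2 * y1 = -(y1 * z2 - y2 * z1) by ring] at e1 e2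
    rcases h1 with h1 | h1 <;> rcases h2 with h2 | h2 <;> rcases h3 with h3 | h3 <;>
      rw [h1, h2, h3] at e1 e2 <;> omega
  rcases key with h | h | h | h
  · exact ⟨_, _, h1, ofVector_toVector X, ofVector_toVector Y, by rw [← h, ofVector_toVector]⟩
  · exact ⟨_, _, h1, ofVector_toVector X, ofVector_toVector Y, by
      rw [← ofVector_neg, ← h, ofVector_toVector]⟩
  · exact ⟨_, _, h1.neg_right, ofVector_toVector X, by rw [ofVector_neg, ofVector_toVector],
      by rw [← h, ofVector_toVector]⟩
  · exact ⟨_, _, h1.neg_right, ofVector_toVector X, by rw [ofVector_neg, ofVector_toVector],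
      by rw [← ofVector_neg, ← h, ofVector_toVector]⟩

end Region

/-! ### Markoff maps as functions on primitive vectors -/

open Region

namespace MarkoffMap

variable {μ : MarkoffParam}

theorem vectorColor_perm {u v : ℤ × ℤ} (h : IsVectorBasis u v) :
    (vectorColor u = 0 ∧ (vectorColor v = 1 ∧ vectorColor (u + v) = 2 ∨
      vectorColor v = 2 ∧ vectorColor (u + v) = 1)) ∨
    (vectorColor u = 1 ∧ (vectorColor v = 0 ∧ vectorColor (u + v) = 2 ∨
      vectorColor v = 2 ∧ vectorColor (u + v) = 0)) ∨
    (vectorColor u = 2 ∧ (vectorColor v = 0 ∧ vectorColor (u + v) = 1 ∨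
      vectorColor v = 1 ∧ vectorColor (u + v) = 0)) := by
  obtain ⟨h1, h2, h3⟩ := vectorColor_cases h
  generalize vectorColor u = i at *
  generalize vectorColor v = j at *
  generalize vectorColor (u + v) = k at *
  revert i j k
  decide

theorem isVectorMarkoff (φ : MarkoffMap μ) : IsVectorMarkoff μ fun u => φ (ofVector u) where
  neg u := by rw [ofVector_neg]
  edge u v hdet := by
    have h : IsVectorBasis u v := Or.inl hdet
    have he := isEdge_ofVector h
    have cu := color_ofVector h.isCoprime
    have cv := color_ofVector h.swap.isCoprime
    rcases vectorColor_perm h with ⟨h1, ⟨h2, h3⟩ | ⟨h2, h3⟩⟩ | ⟨h1, ⟨h2, h3⟩ | ⟨h2, h3⟩⟩ |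
      ⟨h1, ⟨h2, h3⟩ | ⟨h2, h3⟩⟩ <;> rw [h1] at cu <;> rw [h2] at cv <;> rw [h3]
    · exact φ.edge₃ _ _ _ _ cu cv he
    · exact φ.edge₂ _ _ _ _ cu cv he
    · rw [mul_comm]; exact φ.edge₃ _ _ _ _ cv cu he.swap
    · exact φ.edge₁ _ _ _ _ cu cv he
    · rw [mul_comm]; exact φ.edge₂ _ _ _ _ cv cu he.swap
    · rw [mul_comm]; exact φ.edge₁ _ _ _ _ cv cu he.swap
  vertex u v hdet := by
    have h : IsVectorBasis u v := Or.inl hdet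
    have he := isVertex_ofVector h
    have cu := color_ofVector h.isCoprime
    have cv := color_ofVector h.swap.isCoprime
    have cw := color_ofVector h.left.swap.isCoprime
    rcases vectorColor_perm h with ⟨h1, ⟨h2, h3⟩ | ⟨h2, h3⟩⟩ | ⟨h1, ⟨h2, h3⟩ | ⟨h2, h3⟩⟩ |
      ⟨h1, ⟨h2, h3⟩ | ⟨h2, h3⟩⟩ <;> rw [h1] at cu <;> rw [h2] at cv <;> rw [h3] at cw <;>
      rw [h1, h2, h3]
    · have := φ.vertex _ _ _ cu cv cw he
      simp only [IsMarkoffTriple, MarkoffParam.coeff] at this ⊢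
      simp; linear_combination this
    · have := φ.vertex _ _ _ cu cw cv he.rotate.rotate.swap
      simp only [IsMarkoffTriple, MarkoffParam.coeff] at this ⊢
      simp; linear_combination this
    · have := φ.vertex _ _ _ cv cu cw he.swap
      simp only [IsMarkoffTriple, MarkoffParam.coeff] at this ⊢
      simp; linear_combination this
    · have := φ.vertex _ _ _ cw cu cv he.rotate.rotate
      simp only [IsMarkoffTriple, MarkoffParam.coeff] at this ⊢
      simp; linear_combination this
    · have := φ.vertex _ _ _ cv cw cu he.rotate
      simp only [IsMarkoffTriple, MarkoffParam.coeff] at this ⊢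
      simp; linear_combination this
    · have := φ.vertex _ _ _ cw cv cu he.swap.rotate.rotate
      simp only [IsMarkoffTriple, MarkoffParam.coeff] at this ⊢
      simp; linear_combination this

/-- The edge relation makes the value ahead of an edge a polynomial in the three values at the
vertex behind it, so continuity spreads through the sector. -/
theorem continuous_vectorComb (n : ℕ) : ∀ {u v : ℤ × ℤ}, IsVectorBasis u v →
    Continuous (fun φ : MarkoffMap μ => φ (ofVector u)) →
    Continuous (fun φ : MarkoffMap μ => φ (ofVector v)) →
    Continuous (fun φ : MarkoffMap μ => φ (ofVector (u + v))) →
    ∀ a b : ℕ, a + b ≤ n → a.Coprime b →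
      Continuous (fun φ : MarkoffMap μ => φ (ofVector (vectorComb u v a b))) := by
  have key : ∀ {u v : ℤ × ℤ}, IsVectorBasis u v →
      Continuous (fun φ : MarkoffMap μ => φ (ofVector u)) →
      Continuous (fun φ : MarkoffMap μ => φ (ofVector v)) →
      Continuous (fun φ : MarkoffMap μ => φ (ofVector (u - v))) →
      Continuous (fun φ : MarkoffMap μ => φ (ofVector (u + v))) := by
    intro u v h h1 h2 h3
    have : (fun φ : MarkoffMap μ => φ (ofVector (u + v))) = fun φ =>
        μ.coeff (vectorColor (u + v)) - φ (ofVector u) * φ (ofVector v) - φ (ofVector (u - v)) := by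
      funext φ
      linear_combination φ.isVectorMarkoff.edge_of_basis h
    rw [this]
    fun_prop
  induction n with
  | zero =>
    intro u v _ _ _ _ a b hn hab
    obtain ⟨rfl, rfl⟩ : a = 0 ∧ b = 0 := by omega
    simp at hab
  | succ n ih =>
    intro u v h hu hv hw a b hn hab
    rcases Nat.eq_zero_or_pos a with rfl | ha
    · obtain rfl : b = 1 := by simpa using hab
      simpa [vectorComb] using hv
    rcases Nat.eq_zero_or_pos b with rfl | hb
    · obtain rfl : a = 1 := by simpa using hab
      simpa [vectorComb] using hu
    rcases le_total b a with hba | hba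
    · obtain ⟨c, rfl⟩ := Nat.exists_eq_add_of_le' hba
      rw [← vectorComb_left]
      refine ih h.left hu hw (key h.left hu hw ?_) c b (by omega) (by simpa using hab)
      rw [show u - (u + v) = -v by abel, ofVector_neg]
      exact hv
    · obtain ⟨c, rfl⟩ := Nat.exists_eq_add_of_le hba
      rw [← vectorComb_right]
      refine ih h.right hw hv (key h.right hw hv ?_) a c (by omega) (by simpa using hab)
      rw [show u + v - v = u by abel]
      exact hu

theorem continuous_eval (X : Region) : Continuous fun φ : MarkoffMap μ => φ X := by
  have h0 : Continuous fun φ : MarkoffMap μ => (φ X₀, φ Y₀, φ Z₀) := continuous_induced_dom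
  have hx : Continuous fun φ : MarkoffMap μ => φ X₀ := h0.fst
  have hy : Continuous fun φ : MarkoffMap μ => φ Y₀ := h0.snd.fst
  have hz : Continuous fun φ : MarkoffMap μ => φ Z₀ := h0.snd.snd
  have e1 : ofVector (0, 1) = X₀ := by simp [ofVector, X₀]
  have e2 : ofVector (-1, 0) = Y₀ := by simp [ofVector, Y₀]
  have e2' : ofVector (1, 0) = Y₀ := by simp [ofVector, Y₀]
  have e3 : ofVector (-1, 1) = Z₀ := by simp [ofVector, Z₀]
  have b1 : IsVectorBasis (1, 0) (0, 1) := by left; simp [vectorDet]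
  -- Slope `1` is not a base region; its value comes from slope `-1` across the edge between `0` and
  -- `∞`.
  have hw : Continuous fun φ : MarkoffMap μ => φ (ofVector ((1, 0) + (0, 1))) := by
    have : (fun φ : MarkoffMap μ => φ (ofVector ((1, 0) + (0, 1)))) = fun φ =>
        μ.coeff (vectorColor ((1, 0) + (0, 1))) - φ Y₀ * φ X₀ - φ Z₀ := by
      funext φ
      have h := φ.isVectorMarkoff.edge_of_basis b1
      rw [show ((1, 0) : ℤ × ℤ) - (0, 1) = -(-1, 1) by simp, ofVector_neg, e1, e2', e3] at h
      linear_combination h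
    rw [this]
    fun_prop
  have hc := X.isCoprime_toVector
  have hX := X.ofVector_toVector
  generalize X.toVector = u at *
  obtain ⟨a, b⟩ := u
  have hab : a.natAbs.Coprime b.natAbs := Int.isCoprime_iff_gcd_eq_one.1 hc
  have c1 := continuous_vectorComb (μ := μ) _ b1 (by rwa [e2']) (by rwa [e1]) hw
    a.natAbs b.natAbs le_rfl hab
  have c2 := continuous_vectorComb (μ := μ) _ (u := (-1, 0)) (v := (0, 1))
    (by right; simp [vectorDet]) (by rwa [e2]) (by rwa [e1]) (by simpa [e3] using hz)
    a.natAbs b.natAbs le_rfl hab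
  rw [vectorComb_pos] at c1
  rw [vectorComb_neg] at c2
  have hcase : ((a, b) : ℤ × ℤ) = ((a.natAbs : ℤ), (b.natAbs : ℤ)) ∨
      ((a, b) : ℤ × ℤ) = -((a.natAbs : ℤ), (b.natAbs : ℤ)) ∨
      ((a, b) : ℤ × ℤ) = (-(a.natAbs : ℤ), (b.natAbs : ℤ)) ∨
      ((a, b) : ℤ × ℤ) = -(-(a.natAbs : ℤ), (b.natAbs : ℤ)) := by
    simp only [Prod.neg_mk, Prod.mk.injEq]; omega
  rw [← hX]
  rcases hcase with h | h | h | h <;> rw [h]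
  · exact c1
  · simpa only [ofVector_neg] using c1
  · exact c2
  · simpa only [ofVector_neg] using c2

theorem mem_bowditchMarkoffMaps_iff {m : ℝ} (φ : MarkoffMap μ) :
    φ ∈ bowditchMarkoffMaps μ m ↔ IsVectorBowditch (μ.L m) fun u => φ (ofVector u) := by
  constructor
  · rintro ⟨h1, h2⟩
    refine ⟨fun u _ => h1 _, ((h2.image toVector).union (h2.image fun X => -X.toVector)).subset ?_⟩
    rintro u ⟨hu, hle⟩
    rcases toVector_ofVector hu with h | h
    · exact Or.inl ⟨_, hle, h⟩
    · exact Or.inr ⟨_, hle, by simp [h]⟩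
  · rintro ⟨h1, h2⟩
    refine ⟨fun X => ?_, (h2.image ofVector).subset fun X hX => ?_⟩
    · have := h1 _ X.isCoprime_toVector
      simpa only [ofVector_toVector] using this
    · exact ⟨X.toVector, ⟨X.isCoprime_toVector, by
      simpa only [ofVector_toVector, Set.mem_ofPred_eq] using hX⟩, X.ofVector_toVector⟩

end MarkoffMap

theorem MarkoffParam.L_bounds (μ : MarkoffParam) {m : ℝ} (hm : 2 < m) :
    2 < μ.L m ∧ 2 + μ.alpha ≤ μ.L m ∧ μ.centerBound + 1 ≤ μ.L m :=
  ⟨hm.trans_le ((le_max_right _ _).trans (le_max_left _ _)),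
    (le_max_left _ _).trans (le_max_left _ _), le_max_right _ _⟩

theorem isOpen_bowditchMarkoffMaps (μ : MarkoffParam) {m : ℝ} (hm : 2 < m) :
    IsOpen (bowditchMarkoffMaps μ m) := by
  obtain ⟨h1, h2, h3⟩ := μ.L_bounds hm
  have := isOpen_isVectorBowditch h1 h2 h3 (fun φ : MarkoffMap μ => φ.isVectorMarkoff)
    (fun u => MarkoffMap.continuous_eval (ofVector u))
  convert this using 1
  ext φ
  exact φ.mem_bowditchMarkoffMaps_iff

/-! ### Sink bounds -/

/-- If `z` exceeded the bound, the lower-order terms could be absorbed, giving `x² ≤ 4y²` and `xyz ≤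
4x²`. Then `yz ≤ 4x ≤ 8y`, that is `z ≤ 8`. -/
theorem sorted_sink_bound {c s x y z : ℝ} (hc : 0 ≤ c) (hs : 0 ≤ s) (hxy : y ≤ x) (hyz : z ≤ y)
    (hx : x ^ 2 ≤ y ^ 2 + z ^ 2 + c * (y + z) + s)
    (hv : x * y * z ≤ x ^ 2 + y ^ 2 + z ^ 2 + c * (x + y + z) + s) : z ≤ 9 + 3 * c + s := by
  by_contra! hz
  have hz0 : 0 < z := by linarith
  have hy0 : 0 < y := by linarith
  have hx0 : 0 < x := by linarith
  have h1 : x ^ 2 ≤ (2 * y) ^ 2 := by nlinarith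
  have h2 : x ≤ 2 * y := abs_le_of_sq_le_sq' h1 (by linarith) |>.2
  have h3 : x * (y * z) ≤ x * (4 * x) := by nlinarith
  have h4 : y * z ≤ 4 * x := le_of_mul_le_mul_left h3 hx0
  have h5 : y * z ≤ y * 8 := by linarith
  linarith [le_of_mul_le_mul_left h5 hy0]

/-- By Vieta, `x` and `x'` are the roots of the vertex relation as a quadratic, so `x x'` is a
polynomial in `y, z`, and `‖x‖² ≤ ‖x x'‖`. -/
theorem norm_sq_le_of_edge {x x' y z k₁ k₂ k₃ s : ℂ} {c : ℝ} (h2 : ‖k₂‖ ≤ c) (h3 : ‖k₃‖ ≤ c)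
    (hv : x ^ 2 + y ^ 2 + z ^ 2 + x * y * z = k₁ * x + k₂ * y + k₃ * z + s)
    (he : x + x' = k₁ - y * z) (hle : ‖x‖ ≤ ‖x'‖) :
    ‖x‖ ^ 2 ≤ ‖y‖ ^ 2 + ‖z‖ ^ 2 + c * (‖y‖ + ‖z‖) + ‖s‖ := by
  have e : x * x' = y ^ 2 + z ^ 2 - k₂ * y - k₃ * z - s := by linear_combination x * he - hv
  calc ‖x‖ ^ 2 ≤ ‖x * x'‖ := by rw [norm_mul, sq]; gcongr
    _ = ‖y ^ 2 + z ^ 2 - k₂ * y - k₃ * z - s‖ := by rw [e]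
    _ ≤ ‖y ^ 2‖ + ‖z ^ 2‖ + ‖k₂ * y‖ + ‖k₃ * z‖ + ‖s‖ := by
      refine (norm_sub_le _ _).trans ?_
      gcongr
      refine (norm_sub_le _ _).trans ?_
      gcongr
      refine (norm_sub_le _ _).trans ?_
      gcongr
      exact norm_add_le _ _
    _ ≤ ‖y‖ ^ 2 + ‖z‖ ^ 2 + c * ‖y‖ + c * ‖z‖ + ‖s‖ := by
      rw [norm_pow, norm_pow, norm_mul, norm_mul]; gcongr
    _ = _ := by ring

theorem norm_mul_le_of_vertex {x y z k₁ k₂ k₃ s : ℂ} {c : ℝ} (h1 : ‖k₁‖ ≤ c) (h2 : ‖k₂‖ ≤ c)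
    (h3 : ‖k₃‖ ≤ c)
    (hv : x ^ 2 + y ^ 2 + z ^ 2 + x * y * z = k₁ * x + k₂ * y + k₃ * z + s) :
    ‖x‖ * ‖y‖ * ‖z‖ ≤ ‖x‖ ^ 2 + ‖y‖ ^ 2 + ‖z‖ ^ 2 + c * (‖x‖ + ‖y‖ + ‖z‖) + ‖s‖ := by
  have e : x * y * z = k₁ * x + k₂ * y + k₃ * z + s - x ^ 2 - y ^ 2 - z ^ 2 := by
    linear_combination hv
  calc ‖x‖ * ‖y‖ * ‖z‖ = ‖k₁ * x + k₂ * y + k₃ * z + s - x ^ 2 - y ^ 2 - z ^ 2‖ := by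
        rw [← e, norm_mul, norm_mul]
    _ ≤ ‖k₁ * x‖ + ‖k₂ * y‖ + ‖k₃ * z‖ + ‖s‖ + ‖x ^ 2‖ + ‖y ^ 2‖ + ‖z ^ 2‖ := by
      refine (norm_sub_le _ _).trans ?_
      gcongr
      refine (norm_sub_le _ _).trans ?_
      gcongr
      refine (norm_sub_le _ _).trans ?_
      gcongr
      refine (norm_add_le _ _).trans ?_
      gcongr
      exact norm_add₃_le
    _ ≤ c * ‖x‖ + c * ‖y‖ + c * ‖z‖ + ‖s‖ + ‖x‖ ^ 2 + ‖y‖ ^ 2 + ‖z‖ ^ 2 := by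
      simp only [norm_pow, norm_mul]; gcongr
    _ = _ := by ring

theorem isSinkBound_explicit (μ : MarkoffParam) :
    IsSinkBound μ (9 + 3 * (2 * μ.alpha) + ‖μ.s‖) := by
  rintro φ X Y Z ⟨hv, hX, hY, hZ⟩
  obtain ⟨u, v, h, rfl, rfl, rfl⟩ := hv.exists_basis
  have hφ := φ.isVectorMarkoff
  have vx := hφ.vertex_of_basis h
  have eZ := hφ.edge_of_basis h
  have eX := hφ.edge_of_basis h.right.swap
  have eY := hφ.edge_of_basis h.left
  have sZ := isEdge_ofVector h
  have sX := (isEdge_ofVector h.right.swap).symm_ends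
  have sY := (isEdge_ofVector h.left).symm_ends
  rw [show v - (u + v) = -u by abel, ofVector_neg] at eX sX
  rw [show u - (u + v) = -v by abel, ofVector_neg] at eY sY
  rw [show vectorColor (v + (u + v)) = vectorColor u from
    vectorColor_congr (by simp; omega) (by simp; omega)] at eX
  rw [show vectorColor (u + (u + v)) = vectorColor v from
    vectorColor_congr (by simp; omega) (by simp; omega)] at eY
  have nx := norm_sq_le_of_edge (μ.norm_coeff_le _) (μ.norm_coeff_le _) vx
    ((add_comm _ _).trans eX) (hX _ sX)
  have ny := norm_sq_le_of_edge (s := μ.s) (x := φ (ofVector v)) (y := φ (ofVector u))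
    (z := φ (ofVector (u + v))) (μ.norm_coeff_le (vectorColor u))
    (μ.norm_coeff_le (vectorColor (u + v))) (by linear_combination vx)
    ((add_comm _ _).trans eY) (hY _ sY)
  have nz := norm_sq_le_of_edge (s := μ.s) (x := φ (ofVector (u + v))) (y := φ (ofVector u))
    (z := φ (ofVector v)) (μ.norm_coeff_le (vectorColor u))
    (μ.norm_coeff_le (vectorColor v)) (by linear_combination vx) eZ (hZ _ sZ)
  have nv := norm_mul_le_of_vertex (μ.norm_coeff_le _) (μ.norm_coeff_le _) (μ.norm_coeff_le _) vx
  have hα := mul_nonneg zero_le_two μ.alpha_nonneg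
  have hs := norm_nonneg μ.s
  have hx0 := norm_nonneg (φ (ofVector u))
  have hy0 := norm_nonneg (φ (ofVector v))
  have hz0 := norm_nonneg (φ (ofVector (u + v)))
  generalize ‖φ (ofVector u)‖ = x at *
  generalize ‖φ (ofVector v)‖ = y at *
  generalize ‖φ (ofVector (u + v))‖ = z at *
  rw [min_le_iff, min_le_iff]
  rcases le_total x y with hxy | hxy <;> rcases le_total y z with hyz | hyz <;>
    rcases le_total x z with hxz | hxz
  · exact Or.inl (Or.inl (sorted_sink_bound hα hs hyz hxy (by linarith) (by linarith)))
  · exact Or.inl (Or.inl (sorted_sink_bound hα hs hyz hxy (by linarith) (by linarith)))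
  · exact Or.inl (Or.inl (sorted_sink_bound hα hs hyz hxz (by linarith) (by linarith)))
  · exact Or.inr (sorted_sink_bound hα hs hxy hxz (by linarith) (by linarith))
  · exact Or.inl (Or.inr (sorted_sink_bound hα hs hxz hxy (by linarith) (by linarith)))
  · exact Or.inl (Or.inr (sorted_sink_bound hα hs hxz hyz (by linarith) (by linarith)))
  · exact Or.inr (sorted_sink_bound hα hs hxy hyz (by linarith) (by linarith))
  · exact Or.inr (sorted_sink_bound hα hs hxy hyz (by linarith) (by linarith))

theorem exists_isSinkBound (μ : MarkoffParam) : ∃ m : ℝ, 2 < m ∧ IsSinkBound μ m :=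
  ⟨_, by linarith [μ.alpha_nonneg, norm_nonneg μ.s], isSinkBound_explicit μ⟩

/-! ### The half twists and the simple closed curves -/

namespace SphereGroup

@[simp] theorem halfTwist₁_gen (i : Fin 4) : halfTwist₁ (gen i) =
    (![gen 0 * gen 1 * (gen 0)⁻¹, gen 0, gen 2, gen 3] : Fin 4 → SphereGroup) i := by
  simp [halfTwist₁]

@[simp] theorem halfTwist₂_gen (i : Fin 4) : halfTwist₂ (gen i) =
    (![gen 0, gen 1 * gen 2 * (gen 1)⁻¹, gen 1, gen 3] : Fin 4 → SphereGroup) i := by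
  simp [halfTwist₂]

@[simp] theorem halfTwist₂_symm_gen (i : Fin 4) : MulEquiv.symm halfTwist₂ (gen i) =
    (![gen 0, gen 2, (gen 2)⁻¹ * gen 1 * gen 2, gen 3] : Fin 4 → SphereGroup) i := by
  simp [halfTwist₂]

theorem mulAut_ext {f g : MulAut SphereGroup} (h : ∀ i, f (gen i) = g (gen i)) : f = g :=
  MulEquiv.toMonoidHom_injective (hom_ext h)

theorem braid_rel : halfTwist₁ * halfTwist₂ * halfTwist₁ = halfTwist₂ * halfTwist₁ * halfTwist₂ := by
  refine mulAut_ext fun i => ?_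
  fin_cases i <;> simp [MulAut.mul_apply, mul_assoc]

/-- The half twist of the three holes `α, β, γ`. -/
def fullTurn : MulAut SphereGroup := halfTwist₁ * halfTwist₂ * halfTwist₁

theorem gen_three : gen 3 = (gen 0 * gen 1 * gen 2)⁻¹ :=
  eq_inv_of_mul_eq_one_right gen_rel

/-- The full twist of the three holes acts by an inner automorphism, hence trivially on free
homotopy classes. -/
theorem fullTurn_sq : fullTurn * fullTurn = MulAut.conj (gen 0 * gen 1 * gen 2) := by
  refine mulAut_ext fun i => ?_
  fin_cases i <;> simp [fullTurn, MulAut.mul_apply, mul_assoc, gen_three]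

theorem fullTurn_gen (i : Fin 4) : fullTurn (gen i) =
    (![gen 0 * gen 1 * gen 2 * (gen 0 * gen 1)⁻¹, gen 0 * gen 1 * (gen 0)⁻¹, gen 0, gen 3] :
      Fin 4 → SphereGroup) i := by
  fin_cases i <;> simp [fullTurn, MulAut.mul_apply, mul_assoc]

theorem halfTwist₂_inv_mul_fullTurn : halfTwist₂⁻¹ * fullTurn = fullTurn * halfTwist₁⁻¹ := by
  have h : fullTurn * halfTwist₁ = halfTwist₂ * fullTurn := by
    conv_lhs => rw [fullTurn, braid_rel]
    simp only [fullTurn, mul_assoc]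
  rw [inv_mul_eq_iff_eq_mul, ← mul_assoc, ← h, mul_assoc, mul_inv_cancel, mul_one]

/-- This expresses `halfTwist₁` through the two mapping classes which act on slopes by `T` and `S`.
-/
theorem halfTwist₁_eq : halfTwist₁ = halfTwist₂⁻¹ * fullTurn * halfTwist₂⁻¹ := by
  rw [halfTwist₂_inv_mul_fullTurn, fullTurn]
  group

/-- The simple closed curve of slope `a / b`. -/
def positiveCurve (a b : ℕ) : SphereGroup :=
  if a = 0 then gen 0 * gen 1
  else if b = 0 then gen 1 * gen 2
  else if b ≤ a then halfTwist₂⁻¹ (positiveCurve (a - b) b)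
  else halfTwist₁ (positiveCurve a (b - a))
termination_by a + b

theorem positiveCurve_zero_left (b : ℕ) : positiveCurve 0 b = gen 0 * gen 1 := by
  rw [positiveCurve, if_pos rfl]

theorem positiveCurve_zero_right {a : ℕ} (ha : a ≠ 0) : positiveCurve a 0 = gen 1 * gen 2 := by
  rw [positiveCurve, if_neg ha, if_pos rfl]

theorem positiveCurve_add_left {a b : ℕ} (h : a + b ≠ 0) :
    positiveCurve (a + b) b = halfTwist₂⁻¹ (positiveCurve a b) := by
  rcases eq_or_ne b 0 with rfl | hb
  · rw [add_zero, positiveCurve_zero_right (by omega)]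
    simp [mul_assoc]
  · rw [positiveCurve, if_neg h, if_neg hb, if_pos (by omega), Nat.add_sub_cancel]

/-- At equal entries the recursion uses `halfTwist₂⁻¹` instead; the rules agree because `halfTwist₁
(βγ)` and `halfTwist₂⁻¹ (αβ)` are both `αγ`. -/
theorem positiveCurve_add_right (a b : ℕ) :
    positiveCurve a (a + b) = halfTwist₁ (positiveCurve a b) := by
  rcases eq_or_ne a 0 with rfl | ha
  · simp [positiveCurve_zero_left]
  rcases eq_or_ne b 0 with rfl | hb
  · rw [positiveCurve_zero_right ha, positiveCurve, if_neg ha, if_neg (by omega),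
      if_pos (by omega), add_zero, Nat.sub_self, positiveCurve_zero_left]
    simp
  · rw [positiveCurve, if_neg ha, if_neg (by omega), if_neg (by omega), Nat.add_sub_cancel_left]

/-- The simple closed curve whose slope is the ratio of the entries of a primitive vector. -/
def curve (u : ℤ × ℤ) : SphereGroup :=
  if 0 ≤ u.1 * u.2 then positiveCurve u.1.natAbs u.2.natAbs
  else fullTurn (positiveCurve u.2.natAbs u.1.natAbs)

theorem curve_neg (u : ℤ × ℤ) : curve (-u) = curve u := by
  simp [curve]

theorem curve_of_nonneg (a b : ℕ) : curve ((a : ℤ), (b : ℤ)) = positiveCurve a b := by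
  rw [curve, if_pos (by positivity)]; simp

theorem curve_of_neg {a b : ℕ} (ha : a ≠ 0) (hb : b ≠ 0) :
    curve (-(a : ℤ), (b : ℤ)) = fullTurn (positiveCurve b a) := by
  have : 0 < (a : ℤ) * b := by positivity
  rw [curve, if_neg (by simp only; linarith)]; simp

theorem curve_zero_one : curve (0, 1) = gen 0 * gen 1 := by
  have := curve_of_nonneg 0 1
  rwa [positiveCurve_zero_left] at this

theorem curve_one_zero : curve (1, 0) = gen 1 * gen 2 := by
  have := curve_of_nonneg 1 0
  rwa [positiveCurve_zero_right one_ne_zero] at this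

/-! ### Free homotopy of curves -/

theorem CurveRel.refl (g : SphereGroup) : CurveRel g g := Or.inl (IsConj.refl g)

theorem isConj_inv {g h : SphereGroup} (H : IsConj g h) : IsConj g⁻¹ h⁻¹ := by
  obtain ⟨c, hc⟩ := isConj_iff.1 H
  exact isConj_iff.2 ⟨c, by rw [← hc]; group⟩

theorem CurveRel.symm {g h : SphereGroup} (H : CurveRel g h) : CurveRel h g := by
  rcases H with H | H
  · exact Or.inl H.symm
  · exact Or.inr (by simpa using (isConj_inv H).symm)

theorem CurveRel.trans {g h k : SphereGroup} (H : CurveRel g h) (K : CurveRel h k) :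
    CurveRel g k := by
  rcases H with H | H <;> rcases K with K | K
  · exact Or.inl (H.trans K)
  · exact Or.inr (H.trans K)
  · exact Or.inr (H.trans (isConj_inv K))
  · exact Or.inl (by simpa using H.trans (isConj_inv K))

theorem CurveRel.map (θ : MulAut SphereGroup) {g h : SphereGroup} (H : CurveRel g h) :
    CurveRel (θ g) (θ h) := by
  rcases H with H | H
  · exact Or.inl (θ.toMonoidHom.map_isConj H)
  · exact Or.inr (by simpa using θ.toMonoidHom.map_isConj H)

theorem curve_mk_eq_iff {g h : SphereGroup} :
    (Quot.mk CurveRel g : Curve) = Quot.mk CurveRel h ↔ CurveRel g h := by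
  have hequiv : Equivalence CurveRel :=
    ⟨CurveRel.refl, CurveRel.symm, CurveRel.trans⟩
  exact Quot.eq.trans hequiv.eqvGen_iff

theorem curveRel_fullTurn_sq (g : SphereGroup) : CurveRel (fullTurn (fullTurn g)) g := by
  rw [← MulAut.mul_apply, fullTurn_sq]
  exact CurveRel.symm (Or.inl (isConj_iff.2 ⟨_, rfl⟩))

/-- The trace of the image of a group element under a representation. -/
def charTrace (ρ : SphereGroup →* Matrix.SpecialLinearGroup (Fin 2) ℂ) (g : SphereGroup) : ℂ :=
  (ρ g).1.trace

theorem trace_inv (A : Matrix.SpecialLinearGroup (Fin 2) ℂ) : (A⁻¹).1.trace = A.1.trace := by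
  rw [Matrix.SpecialLinearGroup.coe_inv, Matrix.adjugate_fin_two]
  simp [Matrix.trace_fin_two, add_comm]

theorem trace_conj (A B : Matrix.SpecialLinearGroup (Fin 2) ℂ) :
    (A * B * A⁻¹).1.trace = B.1.trace := by
  rw [Matrix.SpecialLinearGroup.coe_mul, Matrix.trace_mul_comm, ← Matrix.SpecialLinearGroup.coe_mul,
    ← mul_assoc, inv_mul_cancel, one_mul]

theorem charTrace_eq_of_curveRel (ρ : SphereGroup →* Matrix.SpecialLinearGroup (Fin 2) ℂ)
    {g h : SphereGroup} (H : CurveRel g h) : charTrace ρ g = charTrace ρ h := by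
  rcases H with H | H <;> obtain ⟨c, hc⟩ := isConj_iff.1 H
  · rw [← hc, charTrace, charTrace, map_mul, map_mul, map_inv, trace_conj]
  · have : charTrace ρ h = charTrace ρ h⁻¹ := by rw [charTrace, charTrace, map_inv, trace_inv]
    rw [this, ← hc, charTrace, charTrace, map_mul, map_mul, map_inv, trace_conj]

/-- The boundary traces of a representation. -/
def boundaryTrace (ρ : SphereGroup →* Matrix.SpecialLinearGroup (Fin 2) ℂ) (i : Fin 4) : ℂ :=
  charTrace ρ (gen i)

/-! ### Equivariance of the curves under the mapping class group -/

/-- The linear action of a matrix on integral vectors. -/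
def linearAct (M : Matrix.SpecialLinearGroup (Fin 2) ℤ) (u : ℤ × ℤ) : ℤ × ℤ :=
  (M 0 0 * u.1 + M 0 1 * u.2, M 1 0 * u.1 + M 1 1 * u.2)

theorem linearAct_one (u : ℤ × ℤ) : linearAct 1 u = u := by
  simp [linearAct]

theorem linearAct_mul (M N : Matrix.SpecialLinearGroup (Fin 2) ℤ) (u : ℤ × ℤ) :
    linearAct (M * N) u = linearAct M (linearAct N u) := by
  ext <;> simp [linearAct, Matrix.mul_apply, Fin.sum_univ_two] <;> ring

theorem isCoprime_linearAct (M : Matrix.SpecialLinearGroup (Fin 2) ℤ) {u : ℤ × ℤ}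
    (hu : IsCoprime u.1 u.2) : IsCoprime (linearAct M u).1 (linearAct M u).2 := by
  obtain ⟨a, b, h⟩ := hu
  have hdet := M.2
  rw [Matrix.det_fin_two] at hdet
  exact ⟨a * M 1 1 - b * M 1 0, b * M 0 0 - a * M 0 1, by
    simp only [linearAct]; linear_combination h + (a * u.1 + b * u.2) * hdet⟩

/-- The mapping class `θ` acts on slopes by the matrix `M`. -/
structure IsEquivariant (M : Matrix.SpecialLinearGroup (Fin 2) ℤ) (θ : MulAut SphereGroup) :
    Prop where
  curve : ∀ u : ℤ × ℤ, IsCoprime u.1 u.2 →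
    CurveRel (θ (SphereGroup.curve u)) (SphereGroup.curve (linearAct M u))
  coeff : ∀ (ρ : SphereGroup →* Matrix.SpecialLinearGroup (Fin 2) ℂ) (u : ℤ × ℤ),
    IsCoprime u.1 u.2 →
    (GT (boundaryTrace (ρ.comp θ.toMonoidHom))).coeff (vectorColor u) =
      (GT (boundaryTrace ρ)).coeff (vectorColor (linearAct M u))
  s : ∀ ρ : SphereGroup →* Matrix.SpecialLinearGroup (Fin 2) ℂ,
    (GT (boundaryTrace (ρ.comp θ.toMonoidHom))).s = (GT (boundaryTrace ρ)).s

theorem IsEquivariant.one : IsEquivariant 1 1 where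
  curve u _ := by rw [linearAct_one]; exact CurveRel.refl _
  coeff ρ u _ := by rw [linearAct_one]; rfl
  s _ := rfl

theorem IsEquivariant.mul {M N : Matrix.SpecialLinearGroup (Fin 2) ℤ} {θ η : MulAut SphereGroup}
    (h : IsEquivariant M θ) (k : IsEquivariant N η) : IsEquivariant (M * N) (θ * η) where
  curve u hu := by
    rw [linearAct_mul, MulAut.mul_apply]
    exact ((k.curve u hu).map θ).trans (h.curve _ (isCoprime_linearAct N hu))
  coeff ρ u hu := by
    rw [linearAct_mul, ← h.coeff ρ _ (isCoprime_linearAct N hu), ← k.coeff _ u hu]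
    rfl
  s ρ := by
    rw [← h.s ρ, ← k.s (ρ.comp θ.toMonoidHom)]
    rfl

theorem IsEquivariant.inv {M : Matrix.SpecialLinearGroup (Fin 2) ℤ} {θ : MulAut SphereGroup}
    (h : IsEquivariant M θ) : IsEquivariant M⁻¹ θ⁻¹ where
  curve u hu := by
    have := (h.curve _ (isCoprime_linearAct M⁻¹ hu)).map θ⁻¹
    rw [← linearAct_mul, mul_inv_cancel, linearAct_one, ← MulAut.mul_apply, inv_mul_cancel] at this
    exact this.symm
  coeff ρ u hu := by
    have := h.coeff (ρ.comp (θ⁻¹).toMonoidHom) _ (isCoprime_linearAct M⁻¹ hu)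
    rw [← linearAct_mul, mul_inv_cancel, linearAct_one] at this
    rw [← this, MonoidHom.comp_assoc]
    congr 3
    ext g
    simp
  s ρ := by
    rw [← h.s, MonoidHom.comp_assoc]
    congr 3
    ext g
    simp

theorem fullTurn_curve_zero_one : fullTurn (gen 0 * gen 1) = gen 0 * (gen 1 * gen 2) * (gen 0)⁻¹ := by
  simp [fullTurn_gen, mul_assoc]

theorem fullTurn_curve_one_zero : fullTurn (gen 1 * gen 2) = gen 0 * gen 1 := by
  simp [fullTurn_gen, mul_assoc]

open ModularGroup in
theorem linearAct_S (a b : ℤ) : linearAct S (a, b) = (-b, a) := by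
  simp [linearAct, coe_S]

open ModularGroup in
theorem linearAct_T (a b : ℤ) : linearAct T (a, b) = (a + b, b) := by
  simp [linearAct, coe_T]

theorem boundaryTrace_comp (ρ : SphereGroup →* Matrix.SpecialLinearGroup (Fin 2) ℂ)
    (θ : MulAut SphereGroup) (π : Fin 4 → Fin 4) (h : ∀ i, ∃ c, θ (gen i) = c * gen (π i) * c⁻¹) :
    boundaryTrace (ρ.comp θ.toMonoidHom) = boundaryTrace ρ ∘ π := by
  funext i
  obtain ⟨c, hc⟩ := h i
  exact (charTrace_eq_of_curveRel ρ (Or.inl (isConj_iff.2 ⟨c, hc.symm⟩))).symm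

theorem odd_of_isCoprime {a b : ℤ} (h : IsCoprime a b) : a % 2 = 1 ∨ b % 2 = 1 := by
  obtain ⟨x, y, h⟩ := h
  by_contra! hc
  obtain ⟨c, hc1⟩ : 2 ∣ a := by omega
  obtain ⟨d, hd1⟩ : 2 ∣ b := by omega
  have : 2 * (x * c + y * d) = 1 := by rw [← h, hc1, hd1]; ring
  omega

-- A quarter turn exchanges positive and negative slopes, and its square is inner, so the two
-- clauses defining `curve` fit together. On boundary classes it exchanges `α` and `γ`, which
-- exchanges `p` and `q`.
open ModularGroup in
theorem isEquivariant_fullTurn : IsEquivariant S fullTurn := by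
  have ht := fun ρ => boundaryTrace_comp ρ fullTurn ![2, 1, 0, 3] (by
    intro i
    fin_cases i
    · exact ⟨gen 0 * gen 1, by simp [fullTurn_gen]⟩
    · exact ⟨gen 0, by simp [fullTurn_gen]⟩
    · exact ⟨1, by simp [fullTurn_gen]⟩
    · exact ⟨1, by simp [fullTurn_gen]⟩)
  refine ⟨?_, ?_, ?_⟩
  · rintro ⟨a, b⟩ hu
    rw [linearAct_S]
    rcases lt_trichotomy (a * b) 0 with h | h | h
    · have h' : 0 ≤ -b * a := by nlinarith
      rw [SphereGroup.curve, SphereGroup.curve, if_neg (not_le.2 h), if_pos h']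
      simpa using curveRel_fullTurn_sq _
    · have hab : IsCoprime a b := hu
      rcases mul_eq_zero.1 h with rfl | rfl
      · have hb : b = 1 ∨ b = -1 := Int.isUnit_iff.1 (isCoprime_zero_left.1 hab)
        have key : CurveRel (fullTurn (SphereGroup.curve (0, 1))) (SphereGroup.curve (1, 0)) := by
          rw [curve_one_zero, curve_zero_one, fullTurn_curve_zero_one]
          exact CurveRel.symm (Or.inl (isConj_iff.2 ⟨gen 0, rfl⟩))
        rcases hb with rfl | rfl
        · have : ((-1, 0) : ℤ × ℤ) = -(1, 0) := by simp
          rw [this, curve_neg]; exact key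
        · have : ((0, -1) : ℤ × ℤ) = -(0, 1) := by simp
          rw [this, curve_neg, neg_neg]; exact key
      · have ha : a = 1 ∨ a = -1 := Int.isUnit_iff.1 (isCoprime_zero_right.1 hab)
        have key : CurveRel (fullTurn (SphereGroup.curve (1, 0))) (SphereGroup.curve (0, 1)) := by
          rw [curve_one_zero, curve_zero_one, fullTurn_curve_one_zero]
          exact CurveRel.refl _
        rcases ha with rfl | rfl
        · rw [neg_zero]; exact key
        · have h1 : ((-1, 0) : ℤ × ℤ) = -(1, 0) := by simp
          have h2 : ((-0, -1) : ℤ × ℤ) = -(0, 1) := by simp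
          rw [h1, h2, curve_neg, curve_neg]; exact key
    · have h' : ¬ 0 ≤ -b * a := by nlinarith
      rw [SphereGroup.curve, SphereGroup.curve, if_pos h.le, if_neg h']
      simpa using CurveRel.refl _
  · rintro ρ ⟨a, b⟩ hu
    rw [linearAct_S, ht]
    have := odd_of_isCoprime hu
    simp only [vectorColor, Int.neg_emod_two]
    rcases Int.emod_two_eq_zero_or_one a with ha | ha <;>
      rcases Int.emod_two_eq_zero_or_one b with hb | hb <;>
      simp [ha, hb, MarkoffParam.coeff, GT] at this ⊢ <;> ring
  · intro ρ
    rw [ht]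
    simp [GT]; ring

-- For nonnegative slopes this is the recursion of `positiveCurve`. For negative ones `halfTwist₂⁻¹`
-- passes `fullTurn` as `halfTwist₁⁻¹` and undoes a Euclidean step; which entry is larger decides
-- the sign of the new slope.
open ModularGroup in
theorem isEquivariant_halfTwist₂_inv : IsEquivariant T halfTwist₂⁻¹ := by
  have ht := fun ρ => boundaryTrace_comp ρ halfTwist₂⁻¹ ![0, 2, 1, 3] (by
    intro i
    fin_cases i
    · exact ⟨1, by simp⟩
    · exact ⟨1, by simp⟩
    · exact ⟨(gen 2)⁻¹, by simp⟩
    · exact ⟨1, by simp⟩)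
  refine ⟨?_, ?_, ?_⟩
  · rintro ⟨a, b⟩ hu
    rw [linearAct_T]
    wlog hb : 0 ≤ b generalizing a b
    · have := this (-a) (-b) hu.neg_neg (by omega)
      rwa [show ((-a, -b) : ℤ × ℤ) = -(a, b) by simp, curve_neg,
        show ((-a + -b, -b) : ℤ × ℤ) = -(a + b, b) by simp; ring, curve_neg] at this
    obtain ⟨n, rfl⟩ := Int.eq_ofNat_of_zero_le hb
    have hpos : ∀ k : ℕ, k + n ≠ 0 → halfTwist₂⁻¹ (SphereGroup.curve ((k : ℤ), (n : ℤ))) =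
        SphereGroup.curve ((k : ℤ) + n, (n : ℤ)) := by
      intro k hk
      rw [curve_of_nonneg, ← positiveCurve_add_left hk, ← curve_of_nonneg]
      push_cast; rfl
    rcases le_or_gt 0 a with ha | ha
    · obtain ⟨k, rfl⟩ := Int.eq_ofNat_of_zero_le ha
      rw [hpos k]
      · exact CurveRel.refl _
      · rintro h0
        obtain ⟨rfl, rfl⟩ : k = 0 ∧ n = 0 := by omega
        exact not_isCoprime_zero_zero hu
    · obtain ⟨k, rfl⟩ : ∃ k : ℕ, a = -(k : ℤ) := ⟨a.natAbs, by omega⟩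
      have hk : k ≠ 0 := by rintro rfl; simp at ha
      rcases eq_or_ne n 0 with rfl | hn
      · have := hpos k (by omega)
        simp only [Nat.cast_zero, add_zero] at this ⊢
        rw [show ((-(k : ℤ), 0) : ℤ × ℤ) = -((k : ℤ), 0) by simp, curve_neg, this]
        exact CurveRel.refl _
      · rw [curve_of_neg hk hn, ← MulAut.mul_apply, halfTwist₂_inv_mul_fullTurn]
        rcases lt_or_ge n k with h | h
        · obtain ⟨c, rfl⟩ := Nat.exists_eq_add_of_le h.le
          rw [positiveCurve_add_right, ← MulAut.mul_apply, mul_assoc, inv_mul_cancel, mul_one,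
            show -((n + c : ℕ) : ℤ) + (n : ℤ) = -(c : ℤ) by push_cast; ring,
            curve_of_neg (by omega) hn]
          exact CurveRel.refl _
        · obtain ⟨c, rfl⟩ := Nat.exists_eq_add_of_le' h
          rw [positiveCurve_add_left (by omega), ← MulAut.mul_apply, mul_assoc,
            show -(k : ℤ) + ((c + k : ℕ) : ℤ) = (c : ℤ) by push_cast; ring, curve_of_nonneg,
            positiveCurve_add_right, show fullTurn * (halfTwist₁⁻¹ * halfTwist₂⁻¹) = halfTwist₁ by
              rw [fullTurn]; group]
          exact CurveRel.refl _
  · rintro ρ ⟨a, b⟩ hu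
    rw [linearAct_T, ht]
    have := odd_of_isCoprime hu
    simp only [vectorColor, Int.add_emod a b]
    rcases Int.emod_two_eq_zero_or_one a with ha | ha <;>
      rcases Int.emod_two_eq_zero_or_one b with hb | hb <;>
      simp [ha, hb, MarkoffParam.coeff, GT] at this ⊢ <;> ring
  · intro ρ
    rw [ht]
    simp [GT]; ring

open ModularGroup in
theorem exists_isEquivariant_of_matrix (M : Matrix.SpecialLinearGroup (Fin 2) ℤ) :
    ∃ θ ∈ mappingClasses, IsEquivariant M θ := by
  have h2 : halfTwist₂⁻¹ ∈ mappingClasses :=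
    inv_mem (Subgroup.subset_closure (by simp))
  have h1 : halfTwist₁ ∈ mappingClasses := Subgroup.subset_closure (by simp)
  have hM : M ∈ Subgroup.closure {S, T} := by
    rw [SpecialLinearGroup.SL2Z_generators]; trivial
  induction hM using Subgroup.closure_induction with
  | mem M hM =>
    rcases hM with rfl | rfl
    · exact ⟨fullTurn, mul_mem (mul_mem h1 (by simpa using inv_mem h2)) h1, isEquivariant_fullTurn⟩
    · exact ⟨_, h2, isEquivariant_halfTwist₂_inv⟩
  | one => exact ⟨1, one_mem _, IsEquivariant.one⟩
  | mul M N _ _ hM hN =>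
    obtain ⟨θ, hθ, h⟩ := hM
    obtain ⟨η, hη, k⟩ := hN
    exact ⟨θ * η, mul_mem hθ hη, h.mul k⟩
  | inv M _ hM =>
    obtain ⟨θ, hθ, h⟩ := hM
    exact ⟨θ⁻¹, inv_mem hθ, h.inv⟩

theorem exists_isEquivariant_of_mappingClass {θ : MulAut SphereGroup} (hθ : θ ∈ mappingClasses) :
    ∃ M, IsEquivariant M θ := by
  induction hθ using Subgroup.closure_induction with
  | mem θ hθ =>
    rcases hθ with rfl | rfl
    · rw [halfTwist₁_eq]
      exact ⟨_, (isEquivariant_halfTwist₂_inv.mul isEquivariant_fullTurn).mul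
        isEquivariant_halfTwist₂_inv⟩
    · rw [← inv_inv halfTwist₂]
      exact ⟨_, isEquivariant_halfTwist₂_inv.inv⟩
  | one => exact ⟨1, IsEquivariant.one⟩
  | mul M N _ _ hM hN =>
    obtain ⟨θ, h⟩ := hM
    obtain ⟨η, k⟩ := hN
    exact ⟨_, h.mul k⟩
  | inv M _ hM =>
    obtain ⟨θ, h⟩ := hM
    exact ⟨_, h.inv⟩

theorem positiveCurve_one_one : positiveCurve 1 1 = gen 0 * gen 2 := by
  rw [positiveCurve_add_right 1 0, positiveCurve_zero_right one_ne_zero]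
  simp

theorem curve_one_one : curve (1, 1) = gen 0 * gen 2 := by
  have := curve_of_nonneg 1 1
  rwa [positiveCurve_one_one] at this

theorem curve_one_neg_one : curve (1, -1) = gen 0 * gen 1 * gen 2 * (gen 1)⁻¹ := by
  rw [curve, if_neg (by norm_num), show (-1 : ℤ).natAbs = 1 from rfl, show (1 : ℤ).natAbs = 1 from rfl,
    positiveCurve_one_one]
  simp [fullTurn_gen, mul_assoc]

theorem exists_linearAct_eq {u : ℤ × ℤ} (hu : IsCoprime u.1 u.2) :
    ∃ M, linearAct M (0, 1) = u := by
  obtain ⟨a, b, h⟩ := hu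
  refine ⟨⟨!![b, u.1; -a, u.2], ?_⟩, ?_⟩
  · rw [Matrix.det_fin_two_of]; linear_combination h
  · ext <;> simp [linearAct]

theorem mk_curve_mem_simpleCurves {u : ℤ × ℤ} (hu : IsCoprime u.1 u.2) :
    Quot.mk _ (curve u) ∈ simpleCurves := by
  obtain ⟨M, rfl⟩ := exists_linearAct_eq hu
  obtain ⟨θ, hθ, h⟩ := exists_isEquivariant_of_matrix M
  refine ⟨θ, hθ, curve_mk_eq_iff.2 ?_⟩
  rw [← curve_zero_one]
  exact (h.curve _ isCoprime_one_right).symm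

theorem exists_curve_of_mem_simpleCurves {c : Curve} (hc : c ∈ simpleCurves) :
    ∃ u : ℤ × ℤ, IsCoprime u.1 u.2 ∧ c = Quot.mk _ (curve u) := by
  obtain ⟨θ, hθ, rfl⟩ := hc
  obtain ⟨M, h⟩ := exists_isEquivariant_of_mappingClass hθ
  refine ⟨linearAct M (0, 1), isCoprime_linearAct M isCoprime_one_right, curve_mk_eq_iff.2 ?_⟩
  rw [← curve_zero_one]
  exact h.curve _ isCoprime_one_right

/-! ### Traces of curves -/

theorem trace_edge_relation (A B C : Matrix.SpecialLinearGroup (Fin 2) ℂ) :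
    (A * C).1.trace + (A * B * C * B⁻¹).1.trace =
      A.1.trace * C.1.trace + B.1.trace * (A * B * C).1.trace
        - (B * C).1.trace * (A * B).1.trace := by
  have hB := B.2
  simp only [Matrix.SpecialLinearGroup.coe_mul, Matrix.SpecialLinearGroup.coe_inv]
  generalize A.1 = a
  generalize B.1 = b at *
  generalize C.1 = c
  rw [Matrix.adjugate_fin_two]
  rw [Matrix.det_fin_two] at hB
  simp only [Matrix.trace_fin_two, Matrix.mul_apply, Fin.sum_univ_two, Matrix.of_apply,
    Matrix.cons_val', Matrix.cons_val_zero, Matrix.cons_val_one, Matrix.cons_val_fin_one]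
  linear_combination (a 0 0 * c 1 1 + a 1 1 * c 0 0 - a 0 1 * c 1 0 - a 1 0 * c 0 1) * hB

theorem trace_vertex_relation (A B C : Matrix.SpecialLinearGroup (Fin 2) ℂ) :
    (A * B).1.trace ^ 2 + (B * C).1.trace ^ 2 + (A * C).1.trace ^ 2
        + (A * B).1.trace * (B * C).1.trace * (A * C).1.trace =
      (A.1.trace * B.1.trace + C.1.trace * (A * B * C).1.trace) * (A * B).1.trace
        + (A.1.trace * (A * B * C).1.trace + B.1.trace * C.1.trace) * (B * C).1.trace
        + (A.1.trace * C.1.trace + B.1.trace * (A * B * C).1.trace) * (A * C).1.trace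
        + (4 - A.1.trace ^ 2 - B.1.trace ^ 2 - C.1.trace ^ 2 - (A * B * C).1.trace ^ 2
          - A.1.trace * B.1.trace * C.1.trace * (A * B * C).1.trace) := by
  -- Carrying the determinants along makes this an identity for arbitrary 2 × 2 matrices, so plain
  -- expansion proves it; they are set to 1 afterwards.
  have key : ∀ a₁ a₂ a₃ a₄ b₁ b₂ b₃ b₄ c₁ c₂ c₃ c₄ dA dB dC a b c d x y z : ℂ,
      dA = a₁ * a₄ - a₂ * a₃ → dB = b₁ * b₄ - b₂ * b₃ → dC = c₁ * c₄ - c₂ * c₃ →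
      a = a₁ + a₄ → b = b₁ + b₄ → c = c₁ + c₄ →
      x = a₁ * b₁ + a₂ * b₃ + (a₃ * b₂ + a₄ * b₄) →
      y = b₁ * c₁ + b₂ * c₃ + (b₃ * c₂ + b₄ * c₄) →
      z = a₁ * c₁ + a₂ * c₃ + (a₃ * c₂ + a₄ * c₄) →
      d = (a₁ * b₁ + a₂ * b₃) * c₁ + (a₁ * b₂ + a₂ * b₄) * c₃ +
        ((a₃ * b₁ + a₄ * b₃) * c₂ + (a₃ * b₂ + a₄ * b₄) * c₄) →
      x ^ 2 * dC + y ^ 2 * dA + z ^ 2 * dB + x * y * z =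
        (a * b * dC + c * d) * x + (a * d + b * c * dA) * y + (a * c * dB + b * d) * z
          + (4 * dA * dB * dC - a ^ 2 * dB * dC - b ^ 2 * dA * dC - c ^ 2 * dA * dB - d ^ 2
            - a * b * c * d) := by
    intros; subst_vars; ring
  have hA := A.2
  have hB := B.2
  have hC := C.2
  simp only [Matrix.SpecialLinearGroup.coe_mul]
  generalize A.1 = a at *
  generalize B.1 = b at *
  generalize C.1 = c at *
  rw [Matrix.det_fin_two, eq_comm] at hA hB hC
  simp only [Matrix.trace_fin_two, Matrix.mul_apply, Fin.sum_univ_two]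
  have := key _ _ _ _ _ _ _ _ _ _ _ _ _ _ _ _ _ _ _ _ _ _ hA hB hC rfl rfl rfl rfl rfl rfl rfl
  linear_combination this

variable (ρ : SphereGroup →* Matrix.SpecialLinearGroup (Fin 2) ℂ)

theorem boundaryTrace_three :
    boundaryTrace ρ 3 = (ρ (gen 0) * ρ (gen 1) * ρ (gen 2)).1.trace := by
  rw [boundaryTrace, charTrace, gen_three, map_inv, trace_inv, map_mul, map_mul]

theorem charTrace_linearAct {M : Matrix.SpecialLinearGroup (Fin 2) ℤ} {θ : MulAut SphereGroup}
    (h : IsEquivariant M θ) {u : ℤ × ℤ} (hu : IsCoprime u.1 u.2) :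
    charTrace ρ (curve (linearAct M u)) = charTrace (ρ.comp θ.toMonoidHom) (curve u) :=
  (charTrace_eq_of_curveRel ρ (h.curve u hu)).symm

/-- The traces of the simple closed curves form a Markoff function. -/
theorem isVectorMarkoff_charTrace :
    IsVectorMarkoff (GT (boundaryTrace ρ)) fun u => charTrace ρ (curve u) := by
  -- A mapping class carries the standard basis to `u, v`, so the relations there are those of the
  -- standard basis for `ρ` composed with it.
  have key : ∀ u v : ℤ × ℤ, vectorDet u v = 1 → ∃ M θ, IsEquivariant M θ ∧
      linearAct M (1, 0) = u ∧ linearAct M (0, 1) = v ∧ linearAct M (1, 1) = u + v ∧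
      linearAct M (1, -1) = u - v := by
    intro u v h
    obtain ⟨θ, -, hθ⟩ := exists_isEquivariant_of_matrix
      ⟨!![u.1, v.1; u.2, v.2], by rw [Matrix.det_fin_two_of, ← h, vectorDet]; ring⟩
    refine ⟨_, θ, hθ, ?_, ?_, ?_, ?_⟩ <;> ext <;> simp [linearAct, sub_eq_add_neg]
  refine ⟨fun u => by rw [curve_neg], fun u v huv => ?_, fun u v huv => ?_⟩
  · obtain ⟨M, θ, h, h1, h2, h3, h4⟩ := key u v huv
    rw [← h1, ← h2, h1, h2, ← h3, ← h4, ← h1, ← h2]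
    have c1 : IsCoprime (1 : ℤ) (-1) := isCoprime_one_left
    rw [charTrace_linearAct ρ h (u := (1, 0)) isCoprime_one_left,
      charTrace_linearAct ρ h (u := (0, 1)) isCoprime_one_right,
      charTrace_linearAct ρ h (u := (1, 1)) isCoprime_one_left,
      charTrace_linearAct ρ h (u := (1, -1)) c1,
      ← h.coeff ρ (1, 1) isCoprime_one_left]
    generalize ρ.comp θ.toMonoidHom = η
    rw [curve_one_zero, curve_zero_one, curve_one_one, curve_one_neg_one]
    simp only [charTrace, map_mul, map_inv]
    rw [trace_edge_relation]
    simp [GT, vectorColor, MarkoffParam.coeff, boundaryTrace_three]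
    simp [boundaryTrace, charTrace]
  · obtain ⟨M, θ, h, h1, h2, h3, -⟩ := key u v huv
    rw [← h3, ← h1, ← h2]
    rw [charTrace_linearAct ρ h (u := (1, 0)) isCoprime_one_left,
      charTrace_linearAct ρ h (u := (0, 1)) isCoprime_one_right,
      charTrace_linearAct ρ h (u := (1, 1)) isCoprime_one_left,
      ← h.coeff ρ (1, 1) isCoprime_one_left, ← h.coeff ρ (1, 0) isCoprime_one_left,
      ← h.coeff ρ (0, 1) isCoprime_one_right, ← h.s]
    generalize ρ.comp θ.toMonoidHom = η
    rw [curve_one_zero, curve_zero_one, curve_one_one]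
    have := trace_vertex_relation (η (gen 0)) (η (gen 1)) (η (gen 2))
    simp only [charTrace, map_mul]
    simp [GT, vectorColor, MarkoffParam.coeff, boundaryTrace_three]
    simp [boundaryTrace, charTrace] at this ⊢
    linear_combination this

end SphereGroup

/-! ### Distinct slopes give distinct curves -/

namespace SphereGroup

/-- An element of order four whose square is `-1` and which exchanges the two coordinate axes. -/
noncomputable def swapMatrix (c : ℂˣ) : Matrix.SpecialLinearGroup (Fin 2) ℂ :=
  ⟨!![0, (c : ℂ); -((c⁻¹ : ℂˣ) : ℂ), 0], by simp [Matrix.det_fin_two_of]⟩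

theorem swapMatrix_val (c : ℂˣ) :
    (swapMatrix c).1 = !![0, (c : ℂ); -((c⁻¹ : ℂˣ) : ℂ), 0] := rfl

theorem swapMatrix_inv (c : ℂˣ) : (swapMatrix c)⁻¹ = swapMatrix (-c) := by
  apply Subtype.ext
  rw [Matrix.SpecialLinearGroup.coe_inv, Matrix.adjugate_fin_two, swapMatrix_val, swapMatrix_val]
  simp

theorem swapMatrix_mul_mul (c d e : ℂˣ) :
    swapMatrix c * swapMatrix d * swapMatrix e = swapMatrix (-(c / d * e)) := by
  apply Subtype.ext
  rw [Matrix.SpecialLinearGroup.coe_mul, Matrix.SpecialLinearGroup.coe_mul, swapMatrix_val,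
    swapMatrix_val, swapMatrix_val, swapMatrix_val, Matrix.mul_fin_two, Matrix.mul_fin_two]
  simp [div_eq_mul_inv]
  ring

theorem swapMatrix_conj (c d : ℂˣ) :
    swapMatrix c * swapMatrix d * (swapMatrix c)⁻¹ = swapMatrix (c * c / d) := by
  rw [swapMatrix_inv, swapMatrix_mul_mul, mul_neg, neg_neg, div_mul_eq_mul_div]

theorem swapMatrix_conj' (c d : ℂˣ) :
    (swapMatrix c)⁻¹ * swapMatrix d * swapMatrix c = swapMatrix (c * c / d) := by
  rw [swapMatrix_inv, swapMatrix_mul_mul, neg_div, neg_mul, neg_neg, div_mul_eq_mul_div]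

theorem trace_swapMatrix_mul (c d : ℂˣ) :
    (swapMatrix c * swapMatrix d).1.trace = -(((c / d : ℂˣ) : ℂ) + (((c / d)⁻¹ : ℂˣ) : ℂ)) := by
  rw [Matrix.SpecialLinearGroup.coe_mul, swapMatrix_val, swapMatrix_val, Matrix.mul_fin_two,
    Matrix.trace_fin_two_of]
  simp [div_eq_mul_inv]
  ring

/-- `ρ` sends the first three boundary curves to the matrices `swapMatrix (c i)`. -/
def IsSwapRep (ρ : SphereGroup →* Matrix.SpecialLinearGroup (Fin 2) ℂ) (c₀ c₁ c₂ : ℂˣ) : Prop :=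
  ρ (gen 0) = swapMatrix c₀ ∧ ρ (gen 1) = swapMatrix c₁ ∧ ρ (gen 2) = swapMatrix c₂

theorem IsSwapRep.halfTwist₁ {ρ : SphereGroup →* Matrix.SpecialLinearGroup (Fin 2) ℂ}
    {c₀ c₁ c₂ : ℂˣ} (h : IsSwapRep ρ c₀ c₁ c₂) :
    IsSwapRep (ρ.comp halfTwist₁.toMonoidHom) (c₀ * c₀ / c₁) c₀ c₂ := by
  obtain ⟨h0, h1, h2⟩ := h
  refine ⟨?_, ?_, ?_⟩ <;> simp [h0, h1, h2, swapMatrix_conj]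

theorem IsSwapRep.halfTwist₂_inv {ρ : SphereGroup →* Matrix.SpecialLinearGroup (Fin 2) ℂ}
    {c₀ c₁ c₂ : ℂˣ} (h : IsSwapRep ρ c₀ c₁ c₂) :
    IsSwapRep (ρ.comp (halfTwist₂⁻¹).toMonoidHom) c₀ c₂ (c₂ * c₂ / c₁) := by
  obtain ⟨h0, h1, h2⟩ := h
  refine ⟨?_, ?_, ?_⟩ <;> simp [h0, h1, h2, swapMatrix_conj']

theorem IsSwapRep.fullTurn {ρ : SphereGroup →* Matrix.SpecialLinearGroup (Fin 2) ℂ}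
    {c₀ c₁ c₂ : ℂˣ} (h : IsSwapRep ρ c₀ c₁ c₂) :
    IsSwapRep (ρ.comp fullTurn.toMonoidHom) (c₀ * c₀ / (c₁ * c₁ / c₂)) (c₀ * c₀ / c₁) c₀ := by
  obtain ⟨h0, h1, h2⟩ := h
  refine ⟨?_, ?_, ?_⟩
  · simp only [MonoidHom.comp_apply, MulEquiv.toMonoidHom_eq_coe, MonoidHom.coe_coe, fullTurn_gen]
    rw [← swapMatrix_conj, ← swapMatrix_conj]
    simp [h0, h1, h2, mul_assoc]
  · simp [fullTurn_gen, h0, h1, swapMatrix_conj]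
  · simp [fullTurn_gen, h0]

/-- Half twists preserve the shape of the representation and only change its parameters. For
example, `halfTwist₂⁻¹` keeps `c₁/c₂` and multiplies `c₀/c₁` by it, so the Euclidean algorithm
builds up a monomial in the two ratios. -/
theorem charTrace_positiveCurve (n : ℕ) :
    ∀ (ρ : SphereGroup →* Matrix.SpecialLinearGroup (Fin 2) ℂ) (c₀ c₁ c₂ : ℂˣ),
    IsSwapRep ρ c₀ c₁ c₂ → ∀ a b : ℕ, a + b ≤ n → a.Coprime b →
    charTrace ρ (positiveCurve a b) =
      -((((c₁ / c₂) ^ a * (c₀ / c₁) ^ b : ℂˣ) : ℂ) +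
        ((((c₁ / c₂) ^ a * (c₀ / c₁) ^ b)⁻¹ : ℂˣ) : ℂ)) := by
  induction n with
  | zero =>
    intro _ _ _ _ _ a b hn hab
    obtain ⟨rfl, rfl⟩ : a = 0 ∧ b = 0 := by omega
    simp at hab
  | succ n ih =>
    intro ρ c₀ c₁ c₂ h a b hn hab
    have ⟨h0, h1, h2⟩ := h
    rcases Nat.eq_zero_or_pos a with rfl | ha
    · obtain rfl : b = 1 := by simpa using hab
      rw [positiveCurve_zero_left, charTrace, map_mul, h0, h1, trace_swapMatrix_mul]
      simp
    rcases Nat.eq_zero_or_pos b with rfl | hb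
    · obtain rfl : a = 1 := by simpa using hab
      rw [positiveCurve_zero_right one_ne_zero, charTrace, map_mul, h1, h2, trace_swapMatrix_mul]
      simp
    rcases le_total b a with hba | hba
    · obtain ⟨a, rfl⟩ := Nat.exists_eq_add_of_le' hba
      rw [positiveCurve_add_left (by omega)]
      have := ih _ _ _ _ h.halfTwist₂_inv a b (by omega) (by simpa using hab)
      have e : (c₂ / (c₂ * c₂ / c₁)) ^ a * (c₀ / c₂) ^ b = (c₁ / c₂) ^ (a + b) * (c₀ / c₁) ^ b := by
        rw [show c₂ / (c₂ * c₂ / c₁) = c₁ / c₂ by ext; push_cast; field_simp, pow_add, mul_assoc, ← mul_pow]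
        simp
      rw [e] at this
      exact this
    · obtain ⟨b, rfl⟩ := Nat.exists_eq_add_of_le hba
      rw [positiveCurve_add_right]
      have := ih _ _ _ _ h.halfTwist₁ a b (by omega) (by simpa using hab)
      have e : (c₀ / c₂) ^ a * (c₀ * c₀ / c₁ / c₀) ^ b =
          (c₁ / c₂) ^ a * (c₀ / c₁) ^ (a + b) := by
        rw [show c₀ * c₀ / c₁ / c₀ = c₀ / c₁ by ext; push_cast; field_simp, pow_add, ← mul_assoc, ← mul_pow]
        simp
      rw [e] at this
      exact this

theorem charTrace_curve {ρ : SphereGroup →* Matrix.SpecialLinearGroup (Fin 2) ℂ} {c₀ c₁ c₂ : ℂˣ}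
    (h : IsSwapRep ρ c₀ c₁ c₂) {u : ℤ × ℤ} (hu : IsCoprime u.1 u.2) :
    charTrace ρ (curve u) =
      -((((c₁ / c₂) ^ u.1 * (c₀ / c₁) ^ u.2 : ℂˣ) : ℂ) +
        ((((c₁ / c₂) ^ u.1 * (c₀ / c₁) ^ u.2)⁻¹ : ℂˣ) : ℂ)) := by
  obtain ⟨x, y⟩ := u
  have hxy : x.natAbs.Coprime y.natAbs := Int.isCoprime_iff_gcd_eq_one.1 hu
  wlog hy : 0 ≤ y generalizing x y
  · have := this (-x) (-y) hu.neg_neg (by simpa using hxy) (by omega)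
    rw [show ((-x, -y) : ℤ × ℤ) = -(x, y) by simp, curve_neg] at this
    rw [this]
    simp only [Prod.fst_neg, Prod.snd_neg, zpow_neg, mul_inv, inv_inv]
    rw [add_comm]
  obtain ⟨b, rfl⟩ := Int.eq_ofNat_of_zero_le hy
  by_cases hx : 0 ≤ x ∨ b = 0
  · have hpos : ∀ a : ℕ, a.Coprime b → charTrace ρ (curve ((a : ℤ), (b : ℤ))) =
        -((((c₁ / c₂) ^ a * (c₀ / c₁) ^ b : ℂˣ) : ℂ) +
          ((((c₁ / c₂) ^ a * (c₀ / c₁) ^ b)⁻¹ : ℂˣ) : ℂ)) := fun a hab => by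
      rw [curve_of_nonneg]
      exact charTrace_positiveCurve _ ρ c₀ c₁ c₂ h a b le_rfl hab
    rcases le_or_gt 0 x with hx' | hx'
    · obtain ⟨a, rfl⟩ := Int.eq_ofNat_of_zero_le hx'
      rw [hpos a (by simpa using hxy)]
      simp
    · obtain rfl : b = 0 := by omega
      obtain rfl : x = -1 := by
        have : x.natAbs = 1 := by simpa using hxy
        omega
      have := hpos 1 (by simp)
      rw [show ((-1, ((0 : ℕ) : ℤ)) : ℤ × ℤ) = -(((1 : ℕ) : ℤ), ((0 : ℕ) : ℤ)) by simp, curve_neg,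
        this]
      simp
      ring
  · push Not at hx
    obtain ⟨a, rfl⟩ : ∃ a : ℕ, x = -(a : ℤ) := ⟨x.natAbs, by omega⟩
    have ha : a ≠ 0 := by rintro rfl; simp at hx
    have := charTrace_positiveCurve _ _ _ _ _ h.fullTurn b a le_rfl
      (by simpa using hxy.symm)
    rw [curve_of_neg ha hx.2]
    refine Eq.trans this ?_
    rw [show c₀ * c₀ / c₁ / c₀ = c₀ / c₁ by ext; push_cast; field_simp,
      show c₀ * c₀ / (c₁ * c₁ / c₂) / (c₀ * c₀ / c₁) = (c₁ / c₂)⁻¹ by ext; push_cast; field_simp]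
    simp only [zpow_neg, zpow_natCast, inv_pow]
    rw [mul_comm]

theorem exists_isSwapRep (c₀ c₁ c₂ : ℂˣ) : ∃ ρ, IsSwapRep ρ c₀ c₁ c₂ := by
  refine ⟨PresentedGroup.toGroup (f := ![swapMatrix c₀, swapMatrix c₁, swapMatrix c₂,
    (swapMatrix c₀ * swapMatrix c₁ * swapMatrix c₂)⁻¹]) ?_, ?_, ?_, ?_⟩
  · rintro w rfl
    simp
  all_goals exact PresentedGroup.toGroup.of _

theorem two_zpow_mul_three_zpow {m n : ℤ} (h : (2 : ℚ) ^ m * 3 ^ n = 1) : m = 0 ∧ n = 0 := by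
  have : Fact (Nat.Prime 2) := ⟨Nat.prime_two⟩
  have : Fact (Nat.Prime 3) := ⟨Nat.prime_three⟩
  have h2 := congrArg (padicValRat 2) h
  have h3 := congrArg (padicValRat 3) h
  have a22 : padicValRat 2 (2 : ℚ) = 1 := by simpa using padicValRat.self (p := 2) (by norm_num)
  have a33 : padicValRat 3 (3 : ℚ) = 1 := by simpa using padicValRat.self (p := 3) (by norm_num)
  have a23 : padicValRat 2 (3 : ℚ) = 0 := by
    have : padicValNat 2 3 = 0 := padicValNat.eq_zero_of_not_dvd (by norm_num)
    rw [show (3 : ℚ) = ((3 : ℕ) : ℚ) by norm_num, padicValRat.of_nat, this, Nat.cast_zero]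
  have a32 : padicValRat 3 (2 : ℚ) = 0 := by
    have : padicValNat 3 2 = 0 := padicValNat.eq_zero_of_not_dvd (by norm_num)
    rw [show (2 : ℚ) = ((2 : ℕ) : ℚ) by norm_num, padicValRat.of_nat, this, Nat.cast_zero]
  rw [padicValRat.mul (by positivity) (by positivity), padicValRat.zpow, padicValRat.zpow,
    padicValRat.one] at h2 h3
  rw [a22, a23] at h2
  rw [a32, a33] at h3
  omega

/-- Parameters `6, 2, 1` give the ratios `2` and `3`. The trace then determines `2 ^ u.1 * 3 ^ u.2`
up to inversion, and unique factorisation recovers `u` up to sign. -/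
theorem eq_or_eq_neg_of_curveRel {u v : ℤ × ℤ} (hu : IsCoprime u.1 u.2) (hv : IsCoprime v.1 v.2)
    (h : CurveRel (curve u) (curve v)) : u = v ∨ u = -v := by
  obtain ⟨ρ, hρ⟩ := exists_isSwapRep (Units.mk0 6 (by norm_num)) (Units.mk0 2 (by norm_num)) 1
  have ht := charTrace_eq_of_curveRel ρ h
  rw [charTrace_curve hρ hu, charTrace_curve hρ hv] at ht
  have e1 : (Units.mk0 (2 : ℂ) (by norm_num)) / 1 = Units.mk0 2 (by norm_num) := div_one _
  have e2 : (Units.mk0 (6 : ℂ) (by norm_num)) / Units.mk0 2 (by norm_num) =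
      Units.mk0 3 (by norm_num) := by ext; simp; norm_num
  rw [e1, e2] at ht
  have key : ∀ x y : ℂˣ, -((x : ℂ) + ((x⁻¹ : ℂˣ) : ℂ)) = -((y : ℂ) + ((y⁻¹ : ℂˣ) : ℂ)) →
      x = y ∨ x = y⁻¹ := by
    intro x y hxy
    have hx : (x : ℂ) * ((x⁻¹ : ℂˣ) : ℂ) = 1 := x.mul_inv
    have hy : (y : ℂ) * ((y⁻¹ : ℂˣ) : ℂ) = 1 := y.mul_inv
    have : ((x : ℂ) - y) * (x - ((y⁻¹ : ℂˣ) : ℂ)) = 0 := by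
      linear_combination (-(x : ℂ)) * hxy - hx + hy
    rcases mul_eq_zero.1 this with h | h
    · exact Or.inl (Units.ext (sub_eq_zero.1 h))
    · exact Or.inr (Units.ext (sub_eq_zero.1 h))
  have fin : ∀ m n : ℤ, (Units.mk0 (2 : ℂ) (by norm_num)) ^ m * (Units.mk0 (3 : ℂ) (by norm_num)) ^ n
      = 1 → m = 0 ∧ n = 0 := by
    intro m n hmn
    have := congrArg Units.val hmn
    simp only [Units.val_mul, Units.val_zpow_eq_zpow_val, Units.val_mk0, Units.val_one] at this
    have h : (((2 : ℚ) ^ m * 3 ^ n : ℚ) : ℂ) = ((1 : ℚ) : ℂ) := by push_cast; exact this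
    exact two_zpow_mul_three_zpow (Rat.cast_injective h)
  rcases key _ _ ht with h | h
  · left
    have := fin (u.1 - v.1) (u.2 - v.2) (by
      rw [zpow_sub, zpow_sub, mul_mul_mul_comm, h, ← mul_inv, mul_inv_cancel])
    ext <;> omega
  · right
    have := fin (u.1 + v.1) (u.2 + v.2) (by
      rw [zpow_add, zpow_add, mul_mul_mul_comm, h, inv_mul_cancel])
    ext <;> simp <;> omega

end SphereGroup

/-! ### Bowditch characters -/

open SphereGroup

theorem RelRep.boundaryTrace_eq {τ : Fin 4 → ℂ} (ρ : RelRep τ) : boundaryTrace ρ.1 = τ :=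
  funext ρ.2

theorem RelRep.continuous_charTrace {τ : Fin 4 → ℂ} (g : SphereGroup) :
    Continuous fun ρ : RelRep τ => charTrace ρ.1 g := by
  have h : Continuous fun ρ : RelRep τ => (ρ.1 g : Matrix.SpecialLinearGroup (Fin 2) ℂ) :=
    (continuous_apply g).comp continuous_induced_dom
  exact (continuous_subtype_val.comp h).matrix_trace

/-- Traces are functions of the free homotopy class, and `curve` maps primitive vectors onto the
simple curves with fibres `{v, -v}`, so finiteness transfers both ways. -/
theorem RelRep.isBowditch_iff {τ : Fin 4 → ℂ} (ρ : RelRep τ) (K : ℝ) :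
    ρ.IsBowditch K ↔ IsVectorBowditch K fun u => charTrace ρ.1 (curve u) := by
  constructor
  · rintro ⟨h1, h2⟩
    refine ⟨fun u hu => h1 _ (mk_curve_mem_simpleCurves hu), ?_⟩
    refine (h2.biUnion (t := fun c => {u | IsCoprime u.1 u.2 ∧ Quot.mk _ (curve u) = c})
      fun c _ => ?_).subset ?_
    · rcases Set.eq_empty_or_nonempty
        {u : ℤ × ℤ | IsCoprime u.1 u.2 ∧ Quot.mk CurveRel (curve u) = c} with he | ⟨v, hv, rfl⟩
      · rw [he]; exact Set.finite_empty
      · refine (Set.toFinite {v, -v}).subset ?_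
        rintro u ⟨hu, huv⟩
        exact eq_or_eq_neg_of_curveRel hu hv (curve_mk_eq_iff.1 huv)
    · rintro u ⟨hu, hle⟩
      exact Set.mem_biUnion ⟨mk_curve_mem_simpleCurves hu, _, rfl, hle⟩ ⟨hu, rfl⟩
  · rintro ⟨h1, h2⟩
    constructor
    · intro g hg
      obtain ⟨u, hu, hgu⟩ := exists_curve_of_mem_simpleCurves hg
      have := charTrace_eq_of_curveRel ρ.1 (curve_mk_eq_iff.1 hgu)
      change charTrace ρ.1 g ∉ _
      rw [this]
      exact h1 u hu
    · refine (h2.image fun u => (Quot.mk _ (curve u) : Curve)).subset ?_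
      rintro c ⟨hc, g, rfl, hle⟩
      obtain ⟨u, hu, hgu⟩ := exists_curve_of_mem_simpleCurves hc
      have := charTrace_eq_of_curveRel ρ.1 (curve_mk_eq_iff.1 hgu)
      refine ⟨u, ⟨hu, ?_⟩, hgu.symm⟩
      change ‖charTrace ρ.1 (curve u)‖ ≤ K
      rw [← this]
      exact hle

/-- Equality of traces is a closed condition, and conjugation invariance gives it on the orbit. -/
theorem RelRep.charTrace_eq_of_mem_closure {τ : Fin 4 → ℂ} {ρ ρ' : RelRep τ}
    (h : ρ' ∈ closure (conjOrbit ρ)) (g : SphereGroup) : charTrace ρ.1 g = charTrace ρ'.1 g := by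
  have hcl : IsClosed {σ : RelRep τ | charTrace ρ.1 g = charTrace σ.1 g} :=
    isClosed_eq continuous_const (RelRep.continuous_charTrace g)
  refine closure_minimal ?_ hcl h
  rintro σ ⟨A, hA⟩
  change charTrace ρ.1 g = charTrace σ.1 g
  rw [charTrace, charTrace, hA, trace_conj]

theorem RelCharVariety.charTrace_eq {τ : Fin 4 → ℂ} {ρ ρ' : RelRep τ}
    (h : (Quot.mk _ ρ : RelCharVariety τ) = Quot.mk _ ρ') (g : SphereGroup) :
    charTrace ρ.1 g = charTrace ρ'.1 g :=
  congrArg (Quot.lift (fun ρ : RelRep τ => charTrace ρ.1 g)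
    fun _ _ h => RelRep.charTrace_eq_of_mem_closure h g) h

theorem isOpen_bowditchCharacters (τ : Fin 4 → ℂ) {m : ℝ} (hm : 2 < m) :
    IsOpen (bowditchCharacters τ m) := by
  obtain ⟨h1, h2, h3⟩ := (GT τ).L_bounds hm
  have hopen := isOpen_isVectorBowditch h1 h2 h3
    (F := fun (ρ : RelRep τ) u => charTrace ρ.1 (curve u))
    (fun ρ => by
      have := isVectorMarkoff_charTrace ρ.1
      rwa [ρ.boundaryTrace_eq] at this)
    (fun u => RelRep.continuous_charTrace (curve u))
  -- The BQ-conditions depend only on traces, which descend to the quotient, so the preimage is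
  -- exactly the open set of representations found above.
  rw [← isQuotientMap_quot_mk.isOpen_preimage]
  convert hopen using 1
  ext ρ
  constructor
  · rintro ⟨ρ', hq, hB⟩
    have := (ρ'.isBowditch_iff _).1 hB
    simp only [RelCharVariety.charTrace_eq hq] at this
    exact this
  · intro hB
    exact ⟨ρ, rfl, (ρ.isBowditch_iff _).2 hB⟩

theorem theorem4 (μ : MarkoffParam) :
    (∃ m : ℝ, 2 < m ∧ IsSinkBound μ m) ∧
    ∀ m : ℝ, 2 < m → IsSinkBound μ m →
      IsOpen (bowditchMarkoffMaps μ m) ∧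
      ∀ τ : Fin 4 → ℂ, GT τ = μ → IsOpen (bowditchCharacters τ m) :=
  ⟨exists_isSinkBound μ, fun _ hm _ =>
    ⟨isOpen_bowditchMarkoffMaps μ hm, fun τ _ => isOpen_bowditchCharacters τ hm⟩⟩
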